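/- Let $d,n\ge 1$ and $m\ge 0$ be integers, let $\alpha=(\alpha_1\ge\dots\ge\alpha_m)$ be a non-increasing sequence of non-negative reals, and let $A\in\mathcal M_d(\mathbb C)$ be positive semidefinite with eigenvalues $\lambda_1\ge\dots\ge\lambda_d\ge 0$, counted with multiplicity. Let $\Lambda_\alpha$ be the set of G-Bessel sequences $\mathcal F=(T_1,\dots,T_m)$ of linear operators $T_i:\mathbb C^d\to\mathbb C^n$ with $\|T_i\|_2^2=\operatorname{tr}(T_i^*T_i)=\alpha_i$, and write $S_{\mathcal F}=\sum_i T_i^*T_i$. Let $$a=\Big(\tfrac{\alpha_1}{n}\mathbf 1_n,\tfrac{\alpha_2}{n}\mathbf 1_n,\dots,\tfrac{\alpha_m}{n}\mathbf 1_n\Big)\in\mathbb R^{mn},$$ let $\mathcal B_{a,d}$ be the set of all $f=(f_k)_{k=1}^{mn}$ in $\mathbb C^d$ with $\|f_k\|^2=a_k$, and write $S_f=\sum_k f_k\otimes f_k$, where $(x\otimes y)z=\langle z,y\rangle x$. A norm $N$ on $\mathcal M_d(\mathbb C)$ is a strictly convex unitarily invariant norm if $N(UXV)=N(X)$ for all $X$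 and all unitary $U,V$, and its restriction to the diagonal matrices is a strictly convex norm on $\mathbb C^d$. For such $N$, a best approximant in $\Lambda_\alpha$ (respectively $\mathcal B_{a,d}$) is an element that minimizes $N(A-S_{\mathcal F})$ over $\Lambda_\alpha$ (respectively $N(A-S_f)$ over $\mathcal B_{a,d}$). 1. (Existence.) For every strictly convex unitarily invariant norm $N$ there is $\mathcal F^{\rm op}\in\Lambda_\alpha$ with $N(A-S_{\mathcal F^{\rm op}})\le N(A-S_{\mathcal F})$ for all $\mathcal F\in\Lambda_\alpha$. 2. (Reduction to the classical problem.) For every such $N$, the minima $\min_{\mathcal F\in\Lambda_\alpha}N(A-S_{\mathcal F})$ and $\min_{f\in\mathcal B_{a,d}}N(A-S_f)$ exist and are equal; $\mathcal F\in\Lambda_\alpha$ is a best approximant if and only if $S_{\mathcal F}=S_f$ for some best approximant $f\in\mathcal B_{a,d}$; and if $f$ is a best approximant in $\mathcal B_{a,d}$, then the operators $T_ix=(\langle x,f_{(i-1)n+j}\rangle)_{j=1}^n$, $1\le i\le m$, form a best approximant in $\Lambda_\alpha$ with the same frame operator. 3. (Computation from $\lambda$ and $a$.) There is a non-decreasing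 vector $b\in\mathbb R^d$ such that, with $a_i:=0$ for $i>mn$ and $x^+=\max(x,0)$, $$\sum_{i\le k}a_i\le\sum_{i\le k}(\lambda_i-b_i)^+\quad(1\le k\le d),\qquad \sum_{i=1}^{mn}a_i=\sum_{i=1}^d(\lambda_i-b_i)^+,$$ and $\sum_{i\le k}a_i=\sum_{i\le k}(\lambda_i-b_i)^+$ whenever $k<d$ and $b_k<b_{k+1}$. For every such $b$, put $\delta_i=\min(b_i,\lambda_i)$. Then for every strictly convex unitarily invariant norm $N$ one has $\min_{\mathcal F\in\Lambda_\alpha}N(A-S_{\mathcal F})=N(\operatorname{diag}(\delta_1,\dots,\delta_d))$, and for $\mathcal F\in\Lambda_\alpha$ the following are equivalent: $\mathcal F$ is a best approximant; the eigenvalues of $A-S_{\mathcal F}$, counted with multiplicity, are $\delta_1,\dots,\delta_d$ in some order; there is a unitary $U$ with $A=U\operatorname{diag}(\lambda_i)U^*$ and $S_{\mathcal F}=U\operatorname{diag}(\lambda_i-\delta_i)U^*$. 4. (Independence of the norm.) If $N$ and $N'$ are strictly convex unitarily invariant norms, then $\mathcal F$ is a best approximant in $\Lambda_\alpha$ for $N$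 if and only if it is one for $N'$. -/

import Mathlib

open scoped Matrix ComplexOrder

noncomputable section

/-- `N` is a strictly convex unitarily invariant norm on the `d × d` complex matrices. `Seminorm`
provides the triangle inequality and homogeneity; strict convexity is required on diagonal
matrices. -/
structure IsStrictlyConvexUIN {d : ℕ} (N : Seminorm ℂ (Matrix (Fin d) (Fin d) ℂ)) : Prop where
  definite : ∀ X, N X = 0 → X = 0
  unitarily_invariant : ∀ (X : Matrix (Fin d) (Fin d) ℂ),
    ∀ U ∈ Matrix.unitaryGroup (Fin d) ℂ, ∀ V ∈ Matrix.unitaryGroup (Fin d) ℂ,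
      N (U * X * V) = N X
  strictly_convex : ∀ x y : Fin d → ℂ, N (Matrix.diagonal x) = 1 → N (Matrix.diagonal y) = 1 →
    x ≠ y → N (Matrix.diagonal (x + y)) < 2

/-- A family `T i` of operators from `ℂ^d` to `ℂ^n`, given by their matrices, is a G-Bessel
sequence. -/
def IsGBessel {d n m : ℕ} (T : Fin m → Matrix (Fin n) (Fin d) ℂ) : Prop :=
  ∃ c : ℝ, 0 < c ∧ ∀ x : EuclideanSpace ℂ (Fin d),
    ∑ i, ‖WithLp.toLp 2 (T i *ᵥ x.ofLp)‖ ^ 2 ≤ c * ‖x‖ ^ 2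

/-- The frame operator `∑ Tᵢ* Tᵢ` of a G-Bessel sequence. -/
def gFrameOperator {d n m : ℕ} (T : Fin m → Matrix (Fin n) (Fin d) ℂ) :
    Matrix (Fin d) (Fin d) ℂ :=
  ∑ i, (T i)ᴴ * T i

/-- The squared Frobenius norm `tr (T* T)`. -/
def frobeniusSq {d n : ℕ} (T : Matrix (Fin n) (Fin d) ℂ) : ℝ := (Tᴴ * T).trace.re

/-- The G-Bessel sequences `(Tᵢ)` from `ℂ^d` to `ℂ^n` with squared Frobenius norms `αᵢ`. -/
def gBesselSet (d n : ℕ) {m : ℕ} (α : Fin m → ℝ) : Set (Fin m → Matrix (Fin n) (Fin d) ℂ) :=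
  {T | IsGBessel T ∧ ∀ i, frobeniusSq (T i) = α i}

/-- The frame operator `∑ f_k ⊗ f_k` of a finite sequence of vectors of `ℂ^d`. -/
def frameOperator {d K : ℕ} (f : Fin K → EuclideanSpace ℂ (Fin d)) :
    Matrix (Fin d) (Fin d) ℂ :=
  ∑ k, Matrix.vecMulVec (f k).ofLp (star (f k).ofLp)

/-- The finite sequences of vectors of `ℂ^d` with squared norms `a_k`. -/
def vectorTorus (d : ℕ) {K : ℕ} (a : Fin K → ℝ) : Set (Fin K → EuclideanSpace ℂ (Fin d)) :=
  {f | ∀ k, ‖f k‖ ^ 2 = a k}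

/-- The weights `(α₁/n, …, α₁/n, α₂/n, …, α₂/n, …, α_m/n, …, α_m/n)`, each repeated `n` times. -/
def spreadWeights (n : ℕ) {m : ℕ} (α : Fin m → ℝ) : Fin (m * n) → ℝ :=
  fun k => α k.divNat / n

/-- The family of operators in which `Tᵢ` has as its `n` rows the conjugates of the vectors of the
`i`-th group of `n` consecutive vectors, that is `Tᵢ x = (⟨x, f_{i n + j}⟩)_j`. -/
def gFrameOfVectors {d n m : ℕ} (f : Fin (m * n) → EuclideanSpace ℂ (Fin d)) :
    Fin m → Matrix (Fin n) (Fin d) ℂ :=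
  fun i => Matrix.of fun j p => star ((f (finProdFinEquiv (i, j))).ofLp p)

/-- `F` is a best approximant of `A` with respect to `N` among the elements of `X`, where
`S F` is the matrix attached to `F`. -/
def IsBestApproximant {ι : Type} {d : ℕ} (N : Seminorm ℂ (Matrix (Fin d) (Fin d) ℂ))
    (A : Matrix (Fin d) (Fin d) ℂ) (S : ι → Matrix (Fin d) (Fin d) ℂ) (X : Set ι) (F : ι) : Prop :=
  F ∈ X ∧ ∀ G ∈ X, N (A - S F) ≤ N (A - S G)

/-- The eigenvalues of a Hermitian matrix, with multiplicity, in non-increasing order. -/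
def sortedEigenvalues {d : ℕ} {A : Matrix (Fin d) (Fin d) ℂ} (hA : A.IsHermitian) : Fin d → ℝ :=
  fun i => hA.eigenvalues₀ (Fin.cast (Fintype.card_fin d).symm i)

/-- The eigenvalues of `X`, with multiplicity, are the real numbers `x i`, in some order. -/
def HasSpectrum {d : ℕ} (X : Matrix (Fin d) (Fin d) ℂ) (x : Fin d → ℝ) : Prop :=
  X.charpoly.roots = Finset.univ.val.map fun i => (x i : ℂ)

/-- The sum of the first `k` entries of a vector (of all of them if there are fewer than `k`). -/
def headSum {K : ℕ} (x : Fin K → ℝ) (k : ℕ) : ℝ :=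
  ∑ i ∈ Finset.univ.filter (fun i : Fin K => i.val < k), x i

/-- The vector `b` of levels of the classical frame operator distance problem with
non-increasing spectrum `lam` and non-increasing weights `a`. It is non-decreasing, hence of the
form `(b₁ 1_{s₁}, …, b_p 1_{s_p})` with `b₁ < ⋯ < b_p`, and on each block but the last the weights
are majorized by `((lam i - b i)⁺)`, while on the last block all remaining weights are majorized by
`((lam i - b i)⁺)`. Since both vectors are non-increasing these majorizations, taken
together, say that the partial sums compare, with equality at the end of each block and for the
total sums. -/
structure IsLevelVector {d K : ℕ} (lam : Fin d → ℝ) (a : Fin K → ℝ) (b : Fin d → ℝ) : Prop where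
  monotone : Monotone b
  headSum_le : ∀ k : ℕ, k ≤ d → headSum a k ≤ headSum (fun i => max (lam i - b i) 0) k
  block_end : ∀ i j : Fin d, i.val + 1 = j.val → b i < b j →
    headSum a j.val = headSum (fun i => max (lam i - b i) 0) j.val
  total : ∑ k, a k = ∑ i, max (lam i - b i) 0

/-- The vector `δ = min (b, lam)` attached to the levels `b`. -/
def levelMin {d : ℕ} (lam b : Fin d → ℝ) : Fin d → ℝ := fun i => min (b i) (lam i)

/-- The diagonal matrix with real entries `x`, as a complex matrix. -/
def realDiagonal {d : ℕ} (x : Fin d → ℝ) : Matrix (Fin d) (Fin d) ℂ :=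
  Matrix.diagonal fun i => (x i : ℂ)

end

/-! Write `ν = (λ - b)⁺ = λ - δ`. Everything rests on the fact that `δ` is majorized by the spectrum
of `A - S_f` for every `f` with weights `a` (`sum_posPart_levelMin_le`). In the complement of the
first `k` vectors, `k` a block end of `b`, only the tail of `a` acts, and it has the same total as
the tail of `ν`; an orthonormal flag adapted to `A` turns this into the required inequality. By
Rado's theorem `δ` is then a convex combination of rearrangements of that spectrum, so a strictly
convex unitarily invariant norm gives `N(diag δ) < N(A - S_f)` unless the spectrum is `δ` itself
(`IsStrictlyConvexUIN.lt_or_hasSpectrum`). The bound is attained: `ν` dominates `a`, so Schur–Horn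
produces vectors with frame operator `diag ν`, which are then rotated into an eigenbasis of `A`.
Minimality thus means "the spectrum is `δ`", a condition without `N`.

Spectrum `δ` forces a common eigenbasis through the Frobenius norm. `ν` is the nearest point to `λ`
among the vectors dominating `a` (`IsLevelVector.sum_sq_add_le`), while Lidskii's inequality bounds
the distance between the spectra of `A` and `S_f` by `‖A - S_f‖₂`; both are equalities here
(`exists_common_isEigenbasis`). The nearest point also yields the existence of `b`.

Operators reduce to vectors because `T* T` is the frame operator of `n` vectors of equal norm, again
by Schur–Horn. -/

/-! ### Partial sums and summation by parts. -/

lemma headSum_add {K : ℕ} (x y : Fin K → ℝ) (k : ℕ) :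
    headSum (x + y) k = headSum x k + headSum y k := by
  simp [headSum, Finset.sum_add_distrib]

lemma headSum_sub {K : ℕ} (x y : Fin K → ℝ) (k : ℕ) :
    headSum (x - y) k = headSum x k - headSum y k := by
  simp [headSum, Finset.sum_sub_distrib]

lemma headSum_of_le {K : ℕ} (x : Fin K → ℝ) {k : ℕ} (h : K ≤ k) : headSum x k = ∑ i, x i := by
  unfold headSum
  rw [Finset.filter_true_of_mem fun i _ => i.isLt.trans_le h]

lemma headSum_zero {K : ℕ} (x : Fin K → ℝ) : headSum x 0 = 0 := by
  simp [headSum]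

lemma headSum_single {K : ℕ} (i : Fin K) (r : ℝ) (k : ℕ) :
    headSum (Pi.single i r) k = if i.val < k then r else 0 := by
  simp [headSum, Pi.single_apply, Finset.sum_ite_eq']

lemma headSum_add_tail {K : ℕ} (x : Fin K → ℝ) (k : ℕ) :
    headSum x k + ∑ i ∈ Finset.univ.filter (fun i : Fin K => k ≤ i.val), x i = ∑ i, x i := by
  rw [headSum, ← Finset.sum_filter_add_sum_filter_not Finset.univ (fun i : Fin K => i.val < k)]
  simp only [not_lt]

lemma headSum_succ {K : ℕ} (x : Fin K → ℝ) (i : Fin K) :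
    headSum x (i.val + 1) = headSum x i.val + x i := by
  have : Finset.univ.filter (fun j : Fin K => j.val < i.val + 1) =
      insert i (Finset.univ.filter (fun j : Fin K => j.val < i.val)) := by
    ext j
    simp [Fin.ext_iff]
    omega
  rw [headSum, this, Finset.sum_insert (by simp), headSum, add_comm]

lemma headSum_castSucc {d : ℕ} (x : Fin (d + 1) → ℝ) {k : ℕ} (hk : k ≤ d) :
    headSum x k = headSum (fun i : Fin d => x i.castSucc) k := by
  have : ¬ d < k := not_lt.2 hk
  simp [headSum, Finset.sum_filter, Fin.sum_univ_castSucc, this]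

lemma continuous_headSum {K : ℕ} (k : ℕ) : Continuous fun x : Fin K → ℝ => headSum x k := by
  unfold headSum
  fun_prop

/-- Summation by parts: a non-increasing vector of weights pairs with `z` to at least its last entry
times the total of `z`, if the partial sums of `z` are non-negative where the weights drop. -/
lemma last_mul_sum_le_sum_mul {d : ℕ} (c z : Fin (d + 1) → ℝ) (hc : Antitone c)
    (h : ∀ i j : Fin (d + 1), i.val + 1 = j.val → c j < c i → 0 ≤ headSum z j.val) :
    c (Fin.last d) * ∑ i, z i ≤ ∑ i, c i * z i := by
  induction d with
  | zero => simp
  | succ d ih =>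
    have key := ih (fun i => c i.castSucc) (fun i => z i.castSucc)
      (fun i j hij => hc (Fin.castSucc_le_castSucc_iff.2 hij)) (fun i j hij hcij => by
        have := h i.castSucc j.castSucc (by simpa using hij) hcij
        rwa [Fin.val_castSucc, headSum_castSucc _ (by omega)] at this)
    have hle : c (Fin.last (d + 1)) ≤ c (Fin.last d).castSucc := hc (Fin.le_last _)
    have hstep : 0 ≤ (c (Fin.last d).castSucc - c (Fin.last (d + 1))) *
        ∑ i : Fin (d + 1), z i.castSucc := by
      rcases hle.eq_or_lt with heq | hlt
      · simp [heq]
      · have := h (Fin.last d).castSucc (Fin.last (d + 1)) (by simp) hlt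
        rw [Fin.val_last, headSum_castSucc _ le_rfl, headSum_of_le _ le_rfl] at this
        exact mul_nonneg (by linarith) this
    rw [Fin.sum_univ_castSucc, Fin.sum_univ_castSucc (f := fun i => c i * z i)]
    linarith

/-- With total zero the last weight drops out. Requiring signs only where `c` drops matters for
level vectors, whose partial sums are prescribed only at the jumps of `b`. -/
lemma sum_mul_nonneg_of_headSum {d : ℕ} (c z : Fin d → ℝ) (hc : Antitone c)
    (h : ∀ i j : Fin d, i.val + 1 = j.val → c j < c i → 0 ≤ headSum z j.val)
    (h0 : ∑ i, z i = 0) : 0 ≤ ∑ i, c i * z i := by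
  cases d with
  | zero => simp
  | succ d => simpa [h0] using last_mul_sum_le_sum_mul c z hc h

/-! ### Majorization and Rado's theorem. -/

/-- Majorization is encoded by the functions `(· - t)⁺`. The threshold `t = x j` recovers the
partial sum, because for the sorted `x` exactly the entries before `j` can exceed it. -/
lemma headSum_le_of_posPart {d : ℕ} {x z : Fin d → ℝ} (hx : Antitone x)
    (h : ∀ t : ℝ, ∑ i, max (z i - t) 0 ≤ ∑ i, max (x i - t) 0) (j : Fin d) :
    headSum z j.val ≤ headSum x j.val := by
  have h1 : headSum z j.val ≤ headSum (fun i => max (z i - x j) 0 + x j) j.val :=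
    Finset.sum_le_sum fun i _ => by have := le_max_left (z i - x j) 0; linarith
  have h2 : headSum (fun i => max (z i - x j) 0) j.val ≤ ∑ i, max (z i - x j) 0 :=
    Finset.sum_le_sum_of_subset_of_nonneg (Finset.filter_subset _ _) fun i _ _ => le_max_right _ _
  have h3 : headSum (fun i => max (x i - x j) 0) j.val = ∑ i, max (x i - x j) 0 := by
    refine Finset.sum_subset (Finset.filter_subset _ _) fun i _ hi => ?_
    have : j ≤ i := by simpa using hi
    exact max_eq_right (sub_nonpos.2 (hx this))
  have h4 : headSum x j.val = headSum (fun i => max (x i - x j) 0 + x j) j.val := by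
    refine Finset.sum_congr rfl fun i hi => ?_
    have : i ≤ j := le_of_lt (by simpa using hi)
    simp only [max_eq_left (sub_nonneg.2 (hx this)), sub_add_cancel]
  have h5 := headSum_add (fun i => max (z i - x j) 0) (fun _ => x j) j.val
  have h6 := headSum_add (fun i => max (x i - x j) 0) (fun _ => x j) j.val
  have h7 := h (x j)
  simp only [Pi.add_def] at h5 h6
  linarith

/-- Rado's theorem: a vector majorized by `x` is in the convex hull of the rearrangements of `x`. -/
lemma mem_convexHull_perm_of_posPart {d : ℕ} {x y : Fin d → ℝ} (hx : Antitone x)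
    (h : ∀ t : ℝ, ∑ i, max (y i - t) 0 ≤ ∑ i, max (x i - t) 0) (hs : ∑ i, y i = ∑ i, x i) :
    y ∈ convexHull ℝ (Set.range fun σ : Equiv.Perm (Fin d) => x ∘ σ) := by
  by_contra hy
  obtain ⟨f, u, hf1, hf2⟩ := geometric_hahn_banach_closed_point (convex_convexHull ℝ _)
    ((Set.finite_range fun σ : Equiv.Perm (Fin d) => x ∘ σ).isClosed_convexHull ℝ) hy
  set c : Fin d → ℝ := fun i => f (Pi.single i 1)
  have hfc : ∀ v : Fin d → ℝ, f v = ∑ i, c i * v i := fun v => by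
    conv_lhs => rw [pi_eq_sum_univ' v]
    rw [map_sum]
    refine Finset.sum_congr rfl fun i _ => ?_
    rw [map_smul, smul_eq_mul, mul_comm]
  -- Placing the largest entries of `x` on the largest coefficients gives a rearrangement where `f`
  -- is at least `f y`, against the separation.
  set σ : Equiv.Perm (Fin d) := Tuple.sort fun i => -c i
  have hσ : Antitone (c ∘ σ) := fun i j hij => by
    have := Tuple.monotone_sort (fun i => -c i) hij
    simpa using this
  have hmem := hf1 (x ∘ ⇑σ⁻¹) (subset_convexHull ℝ _ ⟨σ⁻¹, rfl⟩)
  have hxy : 0 ≤ ∑ i, (c ∘ σ) i * (x - y ∘ σ) i := by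
    refine sum_mul_nonneg_of_headSum _ _ hσ (fun i j _ _ => ?_) ?_
    · rw [headSum_sub, sub_nonneg]
      refine headSum_le_of_posPart hx (fun t => ?_) j
      simpa using (Equiv.sum_comp σ fun i => max (y i - t) 0).trans_le (h t)
    · simp [Finset.sum_sub_distrib, Equiv.sum_comp σ y, hs]
  have e1 : f (x ∘ ⇑σ⁻¹) = ∑ i, c (σ i) * x i := by
    rw [hfc, ← Equiv.sum_comp σ]
    simp
  have e2 : f y = ∑ i, c (σ i) * y (σ i) := by
    rw [hfc, ← Equiv.sum_comp σ]
  simp only [Function.comp_apply, Pi.sub_apply, mul_sub, Finset.sum_sub_distrib] at hxy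
  linarith

/-! ### Level vectors from a nearest-point problem. -/

/-- The vectors `ν ≥ 0` with the same total as `a` and partial sums at least those of `a`. -/
def dominatingVectors (d : ℕ) {K : ℕ} (a : Fin K → ℝ) : Set (Fin d → ℝ) :=
  {ν | (∀ i, 0 ≤ ν i) ∧ (∀ k ≤ d, headSum a k ≤ headSum ν k) ∧ ∑ i, ν i = ∑ k, a k}

lemma headSum_le_sum {K : ℕ} {a : Fin K → ℝ} (ha : ∀ k, 0 ≤ a k) (k : ℕ) :
    headSum a k ≤ ∑ i, a i :=
  Finset.sum_le_sum_of_subset_of_nonneg (Finset.filter_subset _ _) fun i _ _ => ha i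

lemma dominatingVectors_nonempty {d K : ℕ} (hd : 0 < d) {a : Fin K → ℝ} (ha : ∀ k, 0 ≤ a k) :
    (dominatingVectors d a).Nonempty := by
  refine ⟨Pi.single ⟨0, hd⟩ (∑ k, a k), fun i => ?_, fun k _ => ?_, by simp⟩
  · rw [Pi.single_apply]
    split_ifs
    exacts [Finset.sum_nonneg fun k _ => ha k, le_rfl]
  · rw [headSum_single]
    rcases Nat.eq_zero_or_pos k with rfl | hk
    · simp [headSum_zero]
    · simpa [hk] using headSum_le_sum ha k

lemma isCompact_dominatingVectors (d : ℕ) {K : ℕ} (a : Fin K → ℝ) :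
    IsCompact (dominatingVectors d a) := by
  refine (isCompact_Icc (a := (0 : Fin d → ℝ)) (b := fun _ => ∑ k, a k)).of_isClosed_subset
    ?_ fun ν hν => ⟨fun i => hν.1 i, fun i => ?_⟩
  · have e : dominatingVectors d a = (⋂ i, {ν | 0 ≤ ν i}) ∩
        ((⋂ k, ⋂ (_ : k ≤ d), {ν | headSum a k ≤ headSum ν k}) ∩ {ν | ∑ i, ν i = ∑ k, a k}) := by
      ext ν
      simp [dominatingVectors]
    rw [e]
    refine (isClosed_iInter fun i => isClosed_le continuous_const (continuous_apply i)).inter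
      ((isClosed_iInter fun k => isClosed_iInter fun _ =>
        isClosed_le continuous_const (continuous_headSum k)).inter
      (isClosed_eq (by fun_prop) continuous_const))
  · change ν i ≤ ∑ k, a k
    rw [← hν.2.2]
    exact Finset.single_le_sum (fun j _ => hν.1 j) (Finset.mem_univ i)

/-- First-order optimality: moving mass `ε` from `j` to `i` changes the squared distance by `2ε(ε -
g)`, which is negative for `0 < ε ≤ g / 2`. -/
lemma le_of_transfer_mem {d : ℕ} {lam ν : Fin d → ℝ} {Φ : Set (Fin d → ℝ)}
    (hmin : IsMinOn (fun ν => ∑ i, (lam i - ν i) ^ 2) Φ ν) {i j : Fin d} (hij : i ≠ j)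
    {r : ℝ} (hr : 0 < r)
    (h : ∀ ε, 0 < ε → ε ≤ r → ν + Pi.single i ε - Pi.single j ε ∈ Φ) :
    lam i - ν i ≤ lam j - ν j := by
  by_contra! hlt
  set g := (lam i - ν i) - (lam j - ν j)
  have hg : 0 < g := sub_pos.2 hlt
  set ε := min r (g / 2)
  have hε : 0 < ε := lt_min hr (half_pos hg)
  have key := hmin (h ε hε (min_le_left _ _))
  have hdiff : ∑ l, (lam l - (ν + Pi.single i ε - Pi.single j ε : Fin d → ℝ) l) ^ 2 =
      ∑ l, (lam l - ν l) ^ 2 + 2 * ε * (ε - g) := by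
    have : ∀ l, (lam l - (ν + Pi.single i ε - Pi.single j ε : Fin d → ℝ) l) ^ 2 =
        (lam l - ν l) ^ 2 + ((if l = i then ε ^ 2 - 2 * ε * (lam i - ν i) else 0) +
          (if l = j then ε ^ 2 + 2 * ε * (lam j - ν j) else 0)) := fun l => by
      by_cases h1 : l = i
      · subst h1
        simp [hij]
        ring
      · by_cases h2 : l = j
        · subst h2
          simp [h1]
          ring
        · simp [h1, h2]
    simp only [this, Finset.sum_add_distrib, Finset.sum_ite_eq', Finset.mem_univ, if_true, g]
    ring
  simp only [Set.mem_ofPred_eq, hdiff] at key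
  have : ε ≤ g / 2 := min_le_right _ _
  nlinarith

/-- The transfer lowers only the partial sums with `j < k ≤ i`, so slack is needed only there. -/
lemma transfer_mem_dominatingVectors {d K : ℕ} {a : Fin K → ℝ} {ν : Fin d → ℝ}
    (hν : ν ∈ dominatingVectors d a) {i j : Fin d} (hij : i ≠ j) {ε : ℝ} (hε : 0 ≤ ε)
    (hj : ε ≤ ν j) (h : ∀ k ≤ d, i.val ≥ k → j.val < k → headSum a k + ε ≤ headSum ν k) :
    ν + Pi.single i ε - Pi.single j ε ∈ dominatingVectors d a := by
  refine ⟨fun l => ?_, fun k hk => ?_, ?_⟩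
  · have h0 := hν.1 l
    by_cases h1 : l = i
    · subst h1
      simp [hij]
      linarith
    · by_cases h2 : l = j
      · subst h2
        simp [h1]
        linarith
      · simpa [h1, h2] using h0
  · have h0 := hν.2.1 k hk
    rw [headSum_sub, headSum_add, headSum_single, headSum_single]
    split_ifs with h1 h2 h2
    · linarith
    · linarith
    · have := h k hk (not_lt.1 h1) h2
      linarith
    · linarith
  · simp [Finset.sum_add_distrib, Finset.sum_sub_distrib, hν.2.2]

/-- The level vector comes from the point of `dominatingVectors d a` nearest to `lam`. -/
lemma exists_isLevelVector {d K : ℕ} (hd : 0 < d) {lam : Fin d → ℝ} (hl : Antitone lam)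
    {a : Fin K → ℝ} (ha : ∀ k, 0 ≤ a k) : ∃ b, IsLevelVector lam a b := by
  obtain ⟨ν, hν, hmin⟩ := (isCompact_dominatingVectors d a).exists_isMinOn
    (dominatingVectors_nonempty hd ha)
    (f := fun ν => ∑ i, (lam i - ν i) ^ 2) (by fun_prop)
  -- Moving mass to an earlier index is always admissible.
  have hA : ∀ i j : Fin d, i < j → 0 < ν j → lam i - ν i ≤ lam j - ν j := fun i j hij hj =>
    le_of_transfer_mem hmin hij.ne hj fun ε hε hεj =>
      transfer_mem_dominatingVectors hν hij.ne hε.le hεj fun k _ h1 h2 => by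
        have : i.val < j.val := hij
        omega
  -- Moving mass to the next index is admissible while the partial sum in between has slack.
  have hB : ∀ i j : Fin d, i.val + 1 = j.val → 0 < ν i → headSum a j.val < headSum ν j.val →
      lam j - ν j ≤ lam i - ν i := fun i j hij hi hlt => by
    have hne : j ≠ i := fun h => by simp [h] at hij
    refine le_of_transfer_mem hmin hne (lt_min hi (sub_pos.2 hlt)) fun ε hε hεr =>
      transfer_mem_dominatingVectors hν hne hε.le (hεr.trans (min_le_left _ _)) fun k _ h1 h2 => ?_
    obtain rfl : k = j.val := by omega
    have := hεr.trans (min_le_right _ _)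
    linarith
  -- The running maximum of `lam - ν` is monotone. By `hA` it equals `lam - ν` where `ν > 0`, and it
  -- is at least `lam` where `ν = 0`; hence `(lam - b)⁺ = ν`.
  set b : Fin d → ℝ := fun i =>
    (Finset.univ.filter (· ≤ i)).sup' ⟨i, by simp⟩ fun j => lam j - ν j with hb
  have hb_ge : ∀ i, lam i - ν i ≤ b i := fun i =>
    Finset.le_sup' (fun j => lam j - ν j) (by simp : i ∈ Finset.univ.filter (· ≤ i))
  have hb_mono : Monotone b := fun i j hij =>
    Finset.sup'_mono _ (fun l hl => by
      simp only [Finset.mem_filter, Finset.mem_univ, true_and] at hl ⊢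
      exact hl.trans hij) _
  have hb_eq : ∀ i, 0 < ν i → b i = lam i - ν i := fun i hi =>
    le_antisymm (Finset.sup'_le _ _ fun j hj => by
      rcases (by simpa using hj : j ≤ i).eq_or_lt with rfl | hlt
      exacts [le_rfl, hA j i hlt hi]) (hb_ge i)
  have hmax : (fun i => max (lam i - b i) 0) = ν := by
    ext i
    rcases (hν.1 i).eq_or_lt with h0 | hpos
    · have := hb_ge i
      rw [← h0] at this ⊢
      exact max_eq_right (by linarith)
    · rw [hb_eq i hpos, sub_sub_cancel, max_eq_left hpos.le]
  refine ⟨b, hb_mono, ?_, fun i j hij hlt => ?_, ?_⟩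
  · rw [hmax]
    exact hν.2.1
  · rw [hmax]
    have hbj : b j ≤ max (b i) (lam j - ν j) := Finset.sup'_le _ _ fun l hl' => by
      have hlj : l ≤ j := by simpa using hl'
      rcases hlj.eq_or_lt with rfl | hlt'
      · exact le_max_right _ _
      · refine le_max_of_le_left ((hb_ge l).trans (hb_mono ?_))
        have : l.val < j.val := hlt'
        exact Fin.le_def.2 (by omega)
    -- A jump of the running maximum is caused by the new entry itself. It forces `ν i > 0` because
    -- `lam` is non-increasing, and slack at `j` would then contradict `hB`.
    have hj : b i < lam j - ν j := by
      by_contra! hle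
      rw [max_eq_left hle] at hbj
      linarith
    have hij' : i ≤ j := Fin.le_def.2 (by omega)
    have hi : 0 < ν i := by
      refine (hν.1 i).lt_of_ne fun h0 => ?_
      have h1 := hb_ge i
      have h2 := hl hij'
      have h3 := hν.1 j
      linarith
    by_contra hne
    have := hB i j hij hi ((hν.2.1 _ j.isLt.le).lt_of_ne hne)
    linarith [hb_ge i]
  · rw [← hν.2.2]
    exact (congrArg (fun v : Fin d → ℝ => ∑ i, v i) hmax).symm

/-! ### Majorization of the residual by means of orthonormal flags. -/

/-- The numbers `‖⟨e j, w i⟩‖²` sum to one over `j` by Parseval and to at most one over `i` by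
Bessel; apply convexity of `(· - t)⁺`. -/
lemma sum_posPart_le {d : ℕ} {ι : Type*} [Fintype ι]
    (e : OrthonormalBasis (Fin d) ℂ (EuclideanSpace ℂ (Fin d))) (x : Fin d → ℝ)
    {w : ι → EuclideanSpace ℂ (Fin d)} (hw : Orthonormal ℂ w) (t : ℝ) :
    ∑ i, max (∑ j, x j * ‖inner ℂ (e j) (w i)‖ ^ 2 - t) 0 ≤ ∑ j, max (x j - t) 0 := by
  calc ∑ i, max (∑ j, x j * ‖inner ℂ (e j) (w i)‖ ^ 2 - t) 0
      ≤ ∑ i, ∑ j, max (x j - t) 0 * ‖inner ℂ (e j) (w i)‖ ^ 2 := by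
        refine Finset.sum_le_sum fun i _ => max_le ?_ (Finset.sum_nonneg fun j _ =>
          mul_nonneg (le_max_right _ _) (sq_nonneg _))
        have h1 : ∑ j, ‖inner ℂ (e j) (w i)‖ ^ 2 = 1 := by
          rw [e.sum_sq_norm_inner_right, hw.1 i, one_pow]
        calc ∑ j, x j * ‖inner ℂ (e j) (w i)‖ ^ 2 - t
            = ∑ j, (x j - t) * ‖inner ℂ (e j) (w i)‖ ^ 2 := by
              simp only [sub_mul, Finset.sum_sub_distrib, ← Finset.mul_sum, h1, mul_one]
          _ ≤ _ := Finset.sum_le_sum fun j _ =>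
              mul_le_mul_of_nonneg_right (le_max_left _ _) (sq_nonneg _)
    _ = ∑ j, max (x j - t) 0 * ∑ i, ‖inner ℂ (e j) (w i)‖ ^ 2 := by
        rw [Finset.sum_comm]
        simp only [Finset.mul_sum]
    _ ≤ ∑ j, max (x j - t) 0 := by
        refine Finset.sum_le_sum fun j _ => mul_le_of_le_one_right (le_max_right _ _) ?_
        have := hw.sum_inner_products_le (e j) (s := Finset.univ)
        simpa only [norm_inner_symm (e j), e.orthonormal.1 j, one_pow] using this

lemma exists_unit_orthogonal {d : ℕ} {κ : Type*} [Fintype κ] (s : κ → EuclideanSpace ℂ (Fin d))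
    (h : Fintype.card κ < d) :
    ∃ w : EuclideanSpace ℂ (Fin d), ‖w‖ = 1 ∧ ∀ k, inner ℂ (s k) w = 0 := by
  have hker : LinearMap.ker (LinearMap.pi fun k => (innerSL ℂ (s k)).toLinearMap) ≠ ⊥ :=
    LinearMap.ker_ne_bot_of_finrank_lt (by simpa using h)
  obtain ⟨v, hv, hv0⟩ := Submodule.exists_mem_ne_zero_of_ne_bot hker
  have hv' : ∀ k, inner ℂ (s k) v = 0 := fun k => congrFun hv k
  refine ⟨((‖v‖⁻¹ : ℝ) : ℂ) • v, ?_, fun k => by rw [inner_smul_right, hv' k, mul_zero]⟩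
  rw [norm_smul, Complex.norm_real, norm_inv, norm_norm, inv_mul_cancel₀ (norm_ne_zero_iff.2 hv0)]

/-- In the orthogonal complement of the first `k` vectors `f j` there are orthonormal vectors `w i`,
`k ≤ i`, with `w i` in the span of `u 0, …, u i`. -/
lemma exists_orthonormal_flag {d K : ℕ} (f : Fin K → EuclideanSpace ℂ (Fin d))
    (u : Fin d → EuclideanSpace ℂ (Fin d)) (k : ℕ) :
    ∃ w : Fin d → EuclideanSpace ℂ (Fin d),
      (∀ i j : Fin d, k ≤ i.val → k ≤ j.val → inner ℂ (w i) (w j) = if i = j then (1 : ℂ) else 0) ∧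
      (∀ i : Fin d, k ≤ i.val → ∀ j : Fin K, j.val < k → inner ℂ (f j) (w i) = 0) ∧
      (∀ i : Fin d, k ≤ i.val → ∀ j, i < j → inner ℂ (u j) (w i) = 0) := by
  suffices H : ∀ p : ℕ, ∃ w : Fin d → EuclideanSpace ℂ (Fin d),
      (∀ i j : Fin d, k ≤ i.val → i.val < p → k ≤ j.val → j.val < p →
        inner ℂ (w i) (w j) = if i = j then (1 : ℂ) else 0) ∧
      (∀ i : Fin d, k ≤ i.val → i.val < p → ∀ j : Fin K, j.val < k → inner ℂ (f j) (w i) = 0) ∧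
      (∀ i : Fin d, k ≤ i.val → i.val < p → ∀ j, i < j → inner ℂ (u j) (w i) = 0) by
    obtain ⟨w, h1, h2, h3⟩ := H d
    exact ⟨w, fun i j hi hj => h1 i j hi i.isLt hj j.isLt, fun i hi => h2 i hi i.isLt,
      fun i hi => h3 i hi i.isLt⟩
  intro p
  induction p with
  | zero => exact ⟨fun _ => 0, by simp, by simp, by simp⟩
  | succ p ih =>
    obtain ⟨w, h1, h2, h3⟩ := ih
    by_cases hp : k ≤ p ∧ p < d
    swap
    · have hlt : ∀ i : Fin d, k ≤ i.val → i.val < p + 1 → i.val < p := fun i _ _ => by omega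
      exact ⟨w, fun i j hi hi' hj hj' => h1 i j hi (hlt i hi hi') hj (hlt j hj hj'),
        fun i hi hi' => h2 i hi (hlt i hi hi'), fun i hi hi' => h3 i hi (hlt i hi hi')⟩
    set q : Fin d := ⟨p, hp.2⟩
    -- At most `k + (d - 1 - p) + (p - k) = d - 1` orthogonality conditions are imposed, so a unit
    -- vector remains.
    obtain ⟨v, hv, hv0⟩ := exists_unit_orthogonal (d := d)
      (κ := {j : Fin K // j.val < k} ⊕ {j : Fin d // q < j} ⊕ {j : Fin d // k ≤ j.val ∧ j.val < p})
      (Sum.elim (fun j => f j) (Sum.elim (fun j => u j) fun j => w j)) (by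
        have c1 : Fintype.card {j : Fin K // j.val < k} ≤ k := by
          simpa using Fintype.card_le_of_injective
            (fun j : {j : Fin K // j.val < k} => (⟨j.1.val, j.2⟩ : Fin k))
            fun i j hij => by simpa [Fin.ext_iff, Subtype.ext_iff] using hij
        have c2 : Fintype.card {j : Fin d // q < j} ≤ d - 1 - p := by
          simpa using Fintype.card_le_of_injective
            (fun j : {j : Fin d // q < j} => (⟨j.1.val - (p + 1), by
              have : p < j.1.val := j.2
              omega⟩ : Fin (d - 1 - p)))
            fun i j hij => by
              have hi : p < i.1.val := i.2
              have hj : p < j.1.val := j.2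
              simp only [Fin.mk.injEq] at hij
              exact Subtype.ext (Fin.ext (by omega))
        have c3 : Fintype.card {j : Fin d // k ≤ j.val ∧ j.val < p} ≤ p - k := by
          simpa using Fintype.card_le_of_injective
            (fun j : {j : Fin d // k ≤ j.val ∧ j.val < p} => (⟨j.1.val - k, by
              have := j.2
              omega⟩ : Fin (p - k)))
            fun i j hij => by
              have hi := i.2.1
              have hj := j.2.1
              simp only [Fin.mk.injEq] at hij
              exact Subtype.ext (Fin.ext (by omega))
        rw [Fintype.card_sum, Fintype.card_sum]
        omega)
    have hne : ∀ i : Fin d, i.val < p + 1 → i ≠ q → i.val < p := fun i hi hiq => by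
      have : i.val ≠ p := fun h => hiq (Fin.ext h)
      omega
    have hvw : ∀ i : Fin d, k ≤ i.val → i.val < p → inner ℂ (w i) v = 0 := fun i hi hi' =>
      hv0 (Sum.inr (Sum.inr ⟨i, hi, hi'⟩))
    refine ⟨Function.update w q v, fun i j hi hi' hj hj' => ?_, fun i hi hi' j hj => ?_,
      fun i hi hi' j hj => ?_⟩
    · by_cases hiq : i = q <;> by_cases hjq : j = q
      · simp [hiq, hjq, inner_self_eq_norm_sq_to_K, hv]
      · rw [hiq, Function.update_self, Function.update_of_ne hjq, if_neg (Ne.symm hjq),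
          ← inner_conj_symm, hvw j hj (hne j hj' hjq), map_zero]
      · rw [hjq, Function.update_self, Function.update_of_ne hiq, if_neg hiq,
          hvw i hi (hne i hi' hiq)]
      · rw [Function.update_of_ne hiq, Function.update_of_ne hjq,
          h1 i j hi (hne i hi' hiq) hj (hne j hj' hjq)]
    · by_cases hiq : i = q
      · rw [hiq, Function.update_self]
        exact hv0 (Sum.inl ⟨j, hj⟩)
      · rw [Function.update_of_ne hiq]
        exact h2 i hi (hne i hi' hiq) j hj
    · by_cases hiq : i = q
      · rw [hiq, Function.update_self]
        exact hv0 (Sum.inr (Sum.inl ⟨j, hiq ▸ hj⟩))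
      · rw [Function.update_of_ne hiq]
        exact h3 i hi (hne i hi' hiq) j hj

/-- Here `w` lies in the span of `u 0, …, u i`, so its Rayleigh quotient averages entries of `lam`
that are at least `lam i`. -/
lemma le_sum_mul_norm_inner_sq {d : ℕ} {lam : Fin d → ℝ} (hl : Antitone lam)
    (u : OrthonormalBasis (Fin d) ℂ (EuclideanSpace ℂ (Fin d))) {i : Fin d}
    {w : EuclideanSpace ℂ (Fin d)} (hw : ‖w‖ = 1) (h : ∀ j, i < j → inner ℂ (u j) w = 0) :
    lam i ≤ ∑ j, lam j * ‖inner ℂ (u j) w‖ ^ 2 := by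
  calc lam i = ∑ j, lam i * ‖inner ℂ (u j) w‖ ^ 2 := by
        rw [← Finset.mul_sum, u.sum_sq_norm_inner_right, hw, one_pow, mul_one]
    _ ≤ _ := Finset.sum_le_sum fun j _ => by
        rcases le_or_gt j i with hji | hij
        · exact mul_le_mul_of_nonneg_right (hl hji) (sq_nonneg _)
        · simp [h j hij]

/-- Bessel's inequality for each `f j` in the tail; the others are orthogonal to all `w i`. -/
lemma sum_sum_norm_inner_sq_le_tail {d K : ℕ} {ι : Type*} [Fintype ι]
    (f : Fin K → EuclideanSpace ℂ (Fin d)) {w : ι → EuclideanSpace ℂ (Fin d)}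
    (hw : Orthonormal ℂ w) {k : ℕ} (h : ∀ i, ∀ j : Fin K, j.val < k → inner ℂ (f j) (w i) = 0) :
    ∑ i, ∑ j, ‖inner ℂ (f j) (w i)‖ ^ 2 ≤
      ∑ j ∈ Finset.univ.filter (fun j : Fin K => k ≤ j.val), ‖f j‖ ^ 2 := by
  rw [Finset.sum_comm, Finset.sum_filter]
  refine Finset.sum_le_sum fun j _ => ?_
  split_ifs with hj
  · have := hw.sum_inner_products_le (f j) (s := Finset.univ)
    simpa only [norm_inner_symm (f j)] using this
  · simp [h _ j (not_le.1 hj)]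

/-- The residual `lam - (lam - b)⁺` is majorized by the spectrum `x` of the difference of a
positive form with spectrum `lam` and the form of any sequence `f` with weights `a`. -/
lemma sum_posPart_levelMin_le {d K : ℕ} {lam b : Fin d → ℝ} {a : Fin K → ℝ} (hl : Antitone lam)
    (hb : IsLevelVector lam a b) (u e : OrthonormalBasis (Fin d) ℂ (EuclideanSpace ℂ (Fin d)))
    {x : Fin d → ℝ} {f : Fin K → EuclideanSpace ℂ (Fin d)} (hf : ∀ k, ‖f k‖ ^ 2 = a k)
    (hx : ∀ w, ∑ j, x j * ‖inner ℂ (e j) w‖ ^ 2 =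
      ∑ j, lam j * ‖inner ℂ (u j) w‖ ^ 2 - ∑ k, ‖inner ℂ (f k) w‖ ^ 2) (t : ℝ) :
    ∑ i, max (levelMin lam b i - t) 0 ≤ ∑ i, max (x i - t) 0 := by
  -- `k` counts the levels not exceeding `t`. It is a block end of `b` unless it is `0` or `d`,
  -- whence the equality `hhead`.
  obtain ⟨k, hkd, hk⟩ : ∃ k ≤ d, ∀ i : Fin d, b i ≤ t ↔ i.val < k :=
    ⟨(Finset.univ.filter fun i => b i ≤ t).card, (Finset.card_le_univ _).trans_eq (Fintype.card_fin d),
      fun i => (Tuple.lt_card_le_iff_apply_le_of_monotone hb.monotone).symm⟩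
  rcases hkd.eq_or_lt with rfl | hkd
  · have : ∀ i, max (levelMin lam b i - t) 0 = 0 := fun i =>
      max_eq_right (sub_nonpos.2 ((min_le_left _ _).trans ((hk i).2 i.isLt)))
    simp only [this, Finset.sum_const_zero]
    exact Finset.sum_nonneg fun i _ => le_max_right _ _
  set ν : Fin d → ℝ := fun i => max (lam i - b i) 0 with hν
  have hhead : headSum a k = headSum ν k := by
    rcases Nat.eq_zero_or_pos k with rfl | hk0
    · simp [headSum_zero]
    · refine hb.block_end ⟨k - 1, by omega⟩ ⟨k, hkd⟩ (by simp; omega) ?_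
      have h1 := (hk ⟨k - 1, by omega⟩).2 (by simp; omega)
      have h2 := mt (hk ⟨k, hkd⟩).1 (by simp)
      exact h1.trans_lt (not_le.1 h2)
  obtain ⟨w, hw1, hw2, hw3⟩ := exists_orthonormal_flag f u k
  -- These are the indices where `levelMin` exceeds `t`. The other tail indices have `lam i ≤ t < b
  -- i`, so `ν` vanishes there and its sum over `s` is its whole tail.
  set s : Finset (Fin d) := Finset.univ.filter fun i => k ≤ i.val ∧ t < lam i
  have hs : ∀ i : s, k ≤ i.1.val := fun i => (Finset.mem_filter.1 i.2).2.1
  have hw : Orthonormal ℂ fun i : s => w i := orthonormal_iff_ite.2 fun i j => by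
    rw [hw1 i j (hs i) (hs j)]
    simp only [Subtype.ext_iff]
  have htail := sum_sum_norm_inner_sq_le_tail f hw fun i j hj => hw2 i (hs i) j hj
  have hν_tail : ∑ i ∈ s, ν i = ∑ i ∈ Finset.univ.filter (fun i : Fin d => k ≤ i.val), ν i := by
    refine Finset.sum_subset (fun i hi => ?_) fun i hi his => ?_
    · simpa using hs ⟨i, hi⟩
    · have hki : k ≤ i.val := by simpa using hi
      have hli : lam i ≤ t := by simpa [s, hki] using his
      have hbi : t < b i := not_le.1 (mt (hk i).1 (not_lt.2 hki))
      exact max_eq_right (by linarith)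
  have hleft : ∑ i, max (levelMin lam b i - t) 0 = ∑ i ∈ s, (lam i - ν i - t) := by
    rw [Finset.sum_filter]
    refine Finset.sum_congr rfl fun i _ => ?_
    split_ifs with hi
    · have hbi : t < b i := not_le.1 (mt (hk i).1 (not_lt.2 hi.1))
      rw [max_eq_left (sub_nonneg.2 (show t ≤ levelMin lam b i from le_min hbi.le hi.2.le)), hν]
      simp only [levelMin]
      rcases le_total (lam i) (b i) with h | h
      · rw [min_eq_right h, max_eq_right (by linarith)]
        ring
      · rw [min_eq_left h, max_eq_left (by linarith)]
        ring
    · refine max_eq_right (sub_nonpos.2 ?_)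
      by_cases hki : k ≤ i.val
      · exact (min_le_right _ _).trans (not_lt.1 fun h => hi ⟨hki, h⟩)
      · exact (min_le_left _ _).trans ((hk i).2 (not_le.1 hki))
  -- Tested on the flag, the positive form contributes at least `lam i`. The total subtracted by `f`
  -- is bounded by `htail`, hence by the tail of `ν`.
  have hright : ∑ i ∈ s, (lam i - t) - ∑ i : s, ∑ j, ‖inner ℂ (f j) (w i)‖ ^ 2 ≤
      ∑ i, max (x i - t) 0 := by
    refine le_trans ?_ (sum_posPart_le e x hw t)
    rw [← Finset.sum_coe_sort s, ← Finset.sum_sub_distrib]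
    refine Finset.sum_le_sum fun i _ => le_max_of_le_left ?_
    rw [hx]
    have := le_sum_mul_norm_inner_sq hl u (hw.1 i) (hw3 i (hs i))
    linarith
  have e1 := headSum_add_tail a k
  have e2 := headSum_add_tail ν k
  have e3 := hb.total
  simp only [hf] at htail
  rw [hleft]
  rw [Finset.sum_sub_distrib] at hright ⊢
  rw [Finset.sum_sub_distrib]
  linarith

/-- The spectrum of a frame operator dominates the squared norms of its vectors. -/
lemma headSum_le_of_frame_spectrum {d K : ℕ} {μ : Fin d → ℝ} {a : Fin K → ℝ} (hμ : Antitone μ)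
    (u : OrthonormalBasis (Fin d) ℂ (EuclideanSpace ℂ (Fin d)))
    {f : Fin K → EuclideanSpace ℂ (Fin d)} (hf : ∀ k, ‖f k‖ ^ 2 = a k)
    (hu : ∀ w, ∑ j, μ j * ‖inner ℂ (u j) w‖ ^ 2 = ∑ k, ‖inner ℂ (f k) w‖ ^ 2)
    (htot : ∑ k, a k = ∑ i, μ i) (k : ℕ) : headSum a k ≤ headSum μ k := by
  obtain ⟨w, hw1, hw2, hw3⟩ := exists_orthonormal_flag f u k
  set s : Finset (Fin d) := Finset.univ.filter fun i => k ≤ i.val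
  have hs : ∀ i : s, k ≤ i.1.val := fun i => (Finset.mem_filter.1 i.2).2
  have hw : Orthonormal ℂ fun i : s => w i := orthonormal_iff_ite.2 fun i j => by
    rw [hw1 i j (hs i) (hs j)]
    simp only [Subtype.ext_iff]
  have htail := sum_sum_norm_inner_sq_le_tail f hw fun i j hj => hw2 i (hs i) j hj
  -- On the complement of the first `k` vectors the frame form sees only the tail of `a`, which
  -- therefore bounds the tail of `μ`; equal totals turn this into the bound on partial sums.
  have h1 : ∑ i ∈ s, μ i ≤ ∑ i : s, ∑ j, ‖inner ℂ (f j) (w i)‖ ^ 2 := by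
    rw [← Finset.sum_coe_sort s]
    refine Finset.sum_le_sum fun i _ => ?_
    rw [← hu]
    exact le_sum_mul_norm_inner_sq hμ u (hw.1 i) (hw3 i (hs i))
  have e1 := headSum_add_tail a k
  have e2 := headSum_add_tail μ k
  simp only [hf] at htail
  linarith

/-! ### Eigenbases, unitary conjugation and spectra. -/

/-- `e` is an orthonormal basis of eigenvectors of `X`, with eigenvalues `x`. -/
def IsEigenbasis {d : ℕ} (X : Matrix (Fin d) (Fin d) ℂ)
    (e : OrthonormalBasis (Fin d) ℂ (EuclideanSpace ℂ (Fin d))) (x : Fin d → ℝ) : Prop :=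
  ∀ i, Matrix.toEuclideanLin X (e i) = (x i : ℂ) • e i

/-- The unitary matrix whose columns are the vectors of an orthonormal basis. -/
noncomputable def basisMatrix {d : ℕ} (e : OrthonormalBasis (Fin d) ℂ (EuclideanSpace ℂ (Fin d))) :
    Matrix (Fin d) (Fin d) ℂ :=
  Matrix.of fun p i => (e i).ofLp p

lemma basisMatrix_mem_unitaryGroup {d : ℕ}
    (e : OrthonormalBasis (Fin d) ℂ (EuclideanSpace ℂ (Fin d))) :
    basisMatrix e ∈ Matrix.unitaryGroup (Fin d) ℂ :=
  (EuclideanSpace.basisFun (Fin d) ℂ).toMatrix_orthonormalBasis_mem_unitary e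

lemma exists_isEigenbasis {d : ℕ} {X : Matrix (Fin d) (Fin d) ℂ} (hX : X.IsHermitian) :
    ∃ e, IsEigenbasis X e (sortedEigenvalues hX) := by
  -- `eigenvalues₀` lists the eigenvalues in order over `Fin (Fintype.card (Fin d))`, so the
  -- operator's eigenbasis is carried over to `Fin d` by a cast that keeps this order.
  refine ⟨((Matrix.isSymmetric_toEuclideanLin_iff.mpr hX).eigenvectorBasis
    finrank_euclideanSpace).reindex (finCongr (Fintype.card_fin d)), fun i => ?_⟩
  rw [OrthonormalBasis.reindex_apply]
  exact (Matrix.isSymmetric_toEuclideanLin_iff.mpr hX).apply_eigenvectorBasis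
    finrank_euclideanSpace _

lemma sortedEigenvalues_antitone {d : ℕ} {X : Matrix (Fin d) (Fin d) ℂ} (hX : X.IsHermitian) :
    Antitone (sortedEigenvalues hX) :=
  fun _ _ hij => hX.eigenvalues₀_antitone hij

namespace IsEigenbasis

variable {d : ℕ} {X : Matrix (Fin d) (Fin d) ℂ}
  {e : OrthonormalBasis (Fin d) ℂ (EuclideanSpace ℂ (Fin d))} {x : Fin d → ℝ}

lemma inner_apply (h : IsEigenbasis X e x) (w : EuclideanSpace ℂ (Fin d)) :
    inner ℂ w (Matrix.toEuclideanLin X w) = ((∑ j, x j * ‖inner ℂ (e j) w‖ ^ 2 : ℝ) : ℂ) := by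
  have h1 : Matrix.toEuclideanLin X w = ∑ j, inner ℂ (e j) w • ((x j : ℂ) • e j) := by
    conv_lhs => rw [← e.sum_repr' w, map_sum]
    exact Finset.sum_congr rfl fun j _ => by rw [map_smul, h j]
  rw [h1, inner_sum]
  push_cast
  refine Finset.sum_congr rfl fun j _ => ?_
  rw [inner_smul_right, inner_smul_right, ← inner_conj_symm w (e j), ← Complex.mul_conj']
  ring

lemma reindex (h : IsEigenbasis X e x) (σ : Equiv.Perm (Fin d)) :
    IsEigenbasis X (e.reindex σ.symm) (x ∘ σ) := fun i => by
  simpa using h (σ i)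

lemma eq_conj (h : IsEigenbasis X e x) :
    X = basisMatrix e * realDiagonal x * (basisMatrix e)ᴴ := by
  have hU := Matrix.mem_unitaryGroup_iff.1 (basisMatrix_mem_unitaryGroup e)
  have h1 : X * basisMatrix e = basisMatrix e * realDiagonal x := by
    ext p i
    have := congrArg (fun v : EuclideanSpace ℂ (Fin d) => v.ofLp p) (h i)
    simp only [Matrix.ofLp_toLpLin, Matrix.toLin'_apply, PiLp.smul_apply, smul_eq_mul] at this
    rw [realDiagonal, Matrix.mul_diagonal, Matrix.mul_apply]
    simpa [basisMatrix, Matrix.mulVec, dotProduct, mul_comm] using this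
  rw [← h1, Matrix.mul_assoc, ← Matrix.star_eq_conjTranspose, hU, Matrix.mul_one]

end IsEigenbasis

lemma isEigenbasis_realDiagonal {d : ℕ} (x : Fin d → ℝ) :
    IsEigenbasis (realDiagonal x) (EuclideanSpace.basisFun (Fin d) ℂ) x := fun i => by
  ext p
  by_cases h : p = i <;> simp [realDiagonal, h, Matrix.mulVec_diagonal]

section Conjugation

variable {d : ℕ} {U : Matrix (Fin d) (Fin d) ℂ} (x : Fin d → ℝ)

lemma charpoly_conj (hU : U ∈ Matrix.unitaryGroup (Fin d) ℂ) (X : Matrix (Fin d) (Fin d) ℂ) :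
    (U * X * Uᴴ).charpoly = X.charpoly := by
  rw [Matrix.charpoly_mul_comm, ← Matrix.mul_assoc, ← Matrix.star_eq_conjTranspose,
    Matrix.mem_unitaryGroup_iff'.1 hU, Matrix.one_mul]

lemma hasSpectrum_conj (hU : U ∈ Matrix.unitaryGroup (Fin d) ℂ) :
    HasSpectrum (U * realDiagonal x * Uᴴ) x := by
  rw [HasSpectrum, charpoly_conj hU, realDiagonal, Matrix.charpoly_diagonal]
  have := Polynomial.roots_multiset_prod_X_sub_C (Finset.univ.val.map fun i => (x i : ℂ))
  rwa [Multiset.map_map] at this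

lemma trace_conj_mul_self (hU : U ∈ Matrix.unitaryGroup (Fin d) ℂ) :
    (U * realDiagonal x * Uᴴ * (U * realDiagonal x * Uᴴ)).trace = ((∑ i, x i ^ 2 : ℝ) : ℂ) := by
  have hU' : Uᴴ * U = 1 := Matrix.mem_unitaryGroup_iff'.1 hU
  have : U * realDiagonal x * Uᴴ * (U * realDiagonal x * Uᴴ) =
      U * (realDiagonal x * realDiagonal x) * Uᴴ := by
    calc _ = U * realDiagonal x * (Uᴴ * U) * realDiagonal x * Uᴴ := by
          simp only [Matrix.mul_assoc]
      _ = _ := by rw [hU', Matrix.mul_one, Matrix.mul_assoc U]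
  rw [this, Matrix.trace_mul_comm, ← Matrix.mul_assoc, hU', Matrix.one_mul]
  simp [realDiagonal, Matrix.trace, sq]

lemma trace_conj (hU : U ∈ Matrix.unitaryGroup (Fin d) ℂ) :
    (U * realDiagonal x * Uᴴ).trace = ((∑ i, x i : ℝ) : ℂ) := by
  have hU' : Uᴴ * U = 1 := Matrix.mem_unitaryGroup_iff'.1 hU
  rw [Matrix.trace_mul_comm, ← Matrix.mul_assoc, hU', Matrix.one_mul]
  simp [realDiagonal, Matrix.trace]

end Conjugation

lemma trace_mul_self_eq_sum_sq {d : ℕ} {X : Matrix (Fin d) (Fin d) ℂ} (hX : X.IsHermitian) :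
    (X * X).trace = ((∑ i, sortedEigenvalues hX i ^ 2 : ℝ) : ℂ) := by
  obtain ⟨e, he⟩ := exists_isEigenbasis hX
  conv_lhs => rw [he.eq_conj]
  exact trace_conj_mul_self _ (basisMatrix_mem_unitaryGroup e)

lemma trace_eq_sum_sortedEigenvalues {d : ℕ} {X : Matrix (Fin d) (Fin d) ℂ} (hX : X.IsHermitian) :
    X.trace = ((∑ i, sortedEigenvalues hX i : ℝ) : ℂ) := by
  obtain ⟨e, he⟩ := exists_isEigenbasis hX
  conv_lhs => rw [he.eq_conj]
  exact trace_conj _ (basisMatrix_mem_unitaryGroup e)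

lemma hasSpectrum_sortedEigenvalues {d : ℕ} {X : Matrix (Fin d) (Fin d) ℂ} (hX : X.IsHermitian) :
    HasSpectrum X (sortedEigenvalues hX) := by
  obtain ⟨e, he⟩ := exists_isEigenbasis hX
  have := hasSpectrum_conj (sortedEigenvalues hX) (basisMatrix_mem_unitaryGroup e)
  rwa [← he.eq_conj] at this

lemma HasSpectrum.comp_perm {d : ℕ} {X : Matrix (Fin d) (Fin d) ℂ} {x : Fin d → ℝ}
    (h : HasSpectrum X x) (σ : Equiv.Perm (Fin d)) : HasSpectrum X (x ∘ σ) := by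
  have := congrArg (Multiset.map fun i => (x i : ℂ)) (Multiset.map_univ_val_equiv σ)
  rw [Multiset.map_map] at this
  exact h.trans this.symm

lemma exists_perm_of_map_univ_eq {d : ℕ} {x y : Fin d → ℝ} (hy : Antitone y)
    (h : Finset.univ.val.map x = Finset.univ.val.map y) :
    ∃ σ : Equiv.Perm (Fin d), y = x ∘ σ := by
  set σ : Equiv.Perm (Fin d) := Tuple.sort fun i => -x i
  have hσ : Antitone (x ∘ σ) := fun i j hij => by
    have := Tuple.monotone_sort (fun i => -x i) hij
    simpa using this
  refine ⟨σ, List.ofFn_injective (List.Perm.eq_of_sortedGE hy.sortedGE_ofFn hσ.sortedGE_ofFn ?_)⟩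
  refine List.Perm.trans ?_ (σ.ofFn_comp_perm x).symm
  rw [← Multiset.coe_eq_coe]
  simpa [Fin.univ_val_map] using h.symm

lemma HasSpectrum.exists_perm {d : ℕ} {X : Matrix (Fin d) (Fin d) ℂ} {x : Fin d → ℝ}
    (h : HasSpectrum X x) (hX : X.IsHermitian) :
    ∃ σ : Equiv.Perm (Fin d), sortedEigenvalues hX = x ∘ σ := by
  refine exists_perm_of_map_univ_eq (sortedEigenvalues_antitone hX) ?_
  have := congrArg (Multiset.map Complex.re) (h.symm.trans (hasSpectrum_sortedEigenvalues hX))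
  simpa only [Multiset.map_map, Function.comp_def, Complex.ofReal_re] using this

lemma HasSpectrum.trace_mul_self {d : ℕ} {X : Matrix (Fin d) (Fin d) ℂ} {x : Fin d → ℝ}
    (h : HasSpectrum X x) (hX : X.IsHermitian) : (X * X).trace = ((∑ i, x i ^ 2 : ℝ) : ℂ) := by
  obtain ⟨σ, hσ⟩ := h.exists_perm hX
  rw [trace_mul_self_eq_sum_sq hX, hσ, ← Equiv.sum_comp σ (fun i => x i ^ 2)]
  rfl

/-! ### Strictly convex unitarily invariant norms and majorization. -/

section Norm

variable {d : ℕ} {N : Seminorm ℂ (Matrix (Fin d) (Fin d) ℂ)}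

namespace IsStrictlyConvexUIN

lemma apply_conj (hN : IsStrictlyConvexUIN N) {U : Matrix (Fin d) (Fin d) ℂ}
    (hU : U ∈ Matrix.unitaryGroup (Fin d) ℂ) (X : Matrix (Fin d) (Fin d) ℂ) :
    N (U * X * Uᴴ) = N X :=
  hN.unitarily_invariant X U hU Uᴴ (Unitary.star_mem hU)

/-- The permuted standard basis is also an eigenbasis of the diagonal matrix, so the two matrices
are unitarily conjugate. -/
lemma apply_realDiagonal_comp_perm (hN : IsStrictlyConvexUIN N) (x : Fin d → ℝ)
    (σ : Equiv.Perm (Fin d)) : N (realDiagonal (x ∘ σ)) = N (realDiagonal x) := by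
  conv_rhs => rw [((isEigenbasis_realDiagonal x).reindex σ).eq_conj]
  exact (hN.apply_conj (basisMatrix_mem_unitaryGroup _) _).symm

lemma apply_eq_realDiagonal (hN : IsStrictlyConvexUIN N) {X : Matrix (Fin d) (Fin d) ℂ}
    (hX : X.IsHermitian) {x : Fin d → ℝ} (h : HasSpectrum X x) : N X = N (realDiagonal x) := by
  obtain ⟨e, he⟩ := exists_isEigenbasis hX
  obtain ⟨σ, hσ⟩ := h.exists_perm hX
  rw [he.eq_conj, hN.apply_conj (basisMatrix_mem_unitaryGroup e), hσ,
    hN.apply_realDiagonal_comp_perm]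

/-- Strict convexity is given on the unit sphere only, so scale by `r⁻¹`; `r = 0` would make both
vectors zero, hence equal. -/
lemma apply_realDiagonal_add_lt (hN : IsStrictlyConvexUIN N) {y z : Fin d → ℝ} {r : ℝ}
    (hy : N (realDiagonal y) = r) (hz : N (realDiagonal z) = r) (hyz : y ≠ z) :
    N (realDiagonal (y + z)) < 2 * r := by
  have hinj : ∀ {s : ℂ}, s ≠ 0 → (fun i => s * (y i : ℂ)) ≠ fun i => s * (z i : ℂ) :=
    fun hs h => hyz (funext fun i => by simpa [hs] using congrFun h i)
  have hr : 0 < r := by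
    refine lt_of_le_of_ne (hy ▸ apply_nonneg N _) fun h0 => ?_
    have e1 := hN.definite _ (hy.trans h0.symm)
    have e2 := hN.definite _ (hz.trans h0.symm)
    refine hinj one_ne_zero (funext fun i => ?_)
    have := congrFun (congrFun (e1.trans e2.symm) i) i
    simpa [realDiagonal] using this
  have hr' : ((r : ℂ))⁻¹ ≠ 0 := inv_ne_zero (by exact_mod_cast hr.ne')
  have hscale : ∀ v : Fin d → ℂ, N (Matrix.diagonal fun i => (r : ℂ)⁻¹ * v i) =
      r⁻¹ * N (Matrix.diagonal v) := fun v => by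
    have : (Matrix.diagonal fun i => (r : ℂ)⁻¹ * v i) = (r : ℂ)⁻¹ • Matrix.diagonal v := by
      rw [← Matrix.diagonal_smul]
      rfl
    rw [this, map_smul_eq_mul, norm_inv, Complex.norm_real, Real.norm_of_nonneg hr.le]
  have key := hN.strictly_convex (fun i => (r : ℂ)⁻¹ * (y i : ℂ)) (fun i => (r : ℂ)⁻¹ * (z i : ℂ))
    (by rw [hscale]; exact (congrArg _ hy).trans (inv_mul_cancel₀ hr.ne'))
    (by rw [hscale]; exact (congrArg _ hz).trans (inv_mul_cancel₀ hr.ne')) (hinj hr')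
  have e : ((fun i => (r : ℂ)⁻¹ * (y i : ℂ)) + fun i => (r : ℂ)⁻¹ * (z i : ℂ)) =
      fun i => (r : ℂ)⁻¹ * (((y + z) i : ℝ) : ℂ) := by
    ext i
    simp [mul_add]
  rw [e, hscale, inv_mul_lt_iff₀ hr, mul_comm] at key
  exact key

lemma apply_realDiagonal_combo_le (a b : ℝ) (ha : 0 ≤ a) (hb : 0 ≤ b) (y z : Fin d → ℝ) :
    N (realDiagonal (a • y + b • z)) ≤ a * N (realDiagonal y) + b * N (realDiagonal z) := by
  have : realDiagonal (a • y + b • z) = (a : ℂ) • realDiagonal y + (b : ℂ) • realDiagonal z := by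
    ext i j
    by_cases h : i = j <;> simp [realDiagonal, h]
  rw [this]
  refine (map_add_le_add N _ _).trans_eq ?_
  rw [map_smul_eq_mul, map_smul_eq_mul, Complex.norm_real, Complex.norm_real,
    Real.norm_of_nonneg ha, Real.norm_of_nonneg hb]

lemma apply_realDiagonal_combo_lt (hN : IsStrictlyConvexUIN N) {y z : Fin d → ℝ} {r : ℝ}
    (hy : N (realDiagonal y) = r) (hz : N (realDiagonal z) = r) (hyz : y ≠ z) {a b : ℝ}
    (ha : 0 < a) (hb : 0 < b) (hab : a + b = 1) : N (realDiagonal (a • y + b • z)) < r := by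
  wlog hle : a ≤ b generalizing a b y z
  · rw [add_comm]
    exact this hz hy hyz.symm hb ha (by linarith) (by linarith)
  -- For `a ≤ b` this reduces a general convex combination to the midpoint.
  have e : a • y + b • z = a • (y + z) + (b - a) • z := by
    rw [smul_add, sub_smul]
    abel
  have h1 := apply_realDiagonal_combo_le (N := N) a (b - a) ha.le (by linarith) (y + z) z
  have h2 := mul_lt_mul_of_pos_left (hN.apply_realDiagonal_add_lt hy hz hyz) ha
  rw [e]
  rw [hz] at h1
  have h3 : a * (2 * r) + (b - a) * r = r := by linear_combination r * hab
  linarith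

/-- A vector majorized by `x` is a rearrangement of `x` or has a smaller norm. -/
lemma lt_or_eq_comp_perm (hN : IsStrictlyConvexUIN N) {x y : Fin d → ℝ}
    (h : y ∈ convexHull ℝ (Set.range fun σ : Equiv.Perm (Fin d) => x ∘ σ)) :
    N (realDiagonal y) < N (realDiagonal x) ∨ ∃ σ : Equiv.Perm (Fin d), y = x ∘ σ := by
  set r := N (realDiagonal x)
  set T : Set (Fin d → ℝ) := {v | N (realDiagonal v) < r ∨ ∃ σ : Equiv.Perm (Fin d), v = x ∘ σ}
  have hle : ∀ v ∈ T, N (realDiagonal v) ≤ r := by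
    rintro v (hv | ⟨σ, rfl⟩)
    exacts [hv.le, (hN.apply_realDiagonal_comp_perm x σ).le]
  -- Two distinct rearrangements combine to something strictly smaller, so `T` is convex and
  -- contains the hull of the rearrangements.
  have hT : Convex ℝ T := by
    refine convex_iff_forall_pos.2 fun v hv w hw a b ha hb hab => ?_
    have hc := apply_realDiagonal_combo_le (N := N) a b ha.le hb.le v w
    have h1 := mul_le_mul_of_nonneg_left (hle v hv) ha.le
    have h2 := mul_le_mul_of_nonneg_left (hle w hw) hb.le
    have h3 : a * r + b * r = r := by rw [← add_mul, hab, one_mul]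
    by_cases hvr : N (realDiagonal v) < r
    · have := mul_lt_mul_of_pos_left hvr ha
      exact Or.inl (by linarith)
    by_cases hwr : N (realDiagonal w) < r
    · have := mul_lt_mul_of_pos_left hwr hb
      exact Or.inl (by linarith)
    by_cases hvw : v = w
    · subst hvw
      rwa [← add_smul, hab, one_smul]
    · exact Or.inl (hN.apply_realDiagonal_combo_lt ((hle v hv).antisymm (not_lt.1 hvr))
        ((hle w hw).antisymm (not_lt.1 hwr)) hvw ha hb hab)
  exact convexHull_min (by rintro _ ⟨σ, rfl⟩; exact Or.inr ⟨σ, rfl⟩) hT h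

end IsStrictlyConvexUIN

/-- Expanding in matrix units bounds `N` by a continuous function of the entries vanishing at zero;
continuity at zero suffices for a seminorm. -/
lemma Seminorm.continuous_matrix (N : Seminorm ℂ (Matrix (Fin d) (Fin d) ℂ)) :
    Continuous N := by
  refine Seminorm.continuous_of_continuousAt_zero ?_
  have hle : ∀ X, N X ≤ ∑ i, ∑ j, ‖X i j‖ * N (Matrix.single i j 1) := fun X => by
    conv_lhs => rw [Matrix.matrix_eq_sum_single X]
    refine (Finset.le_sum_of_subadditive N (map_zero N).le (map_add_le_add N) _ _).trans (Finset.sum_le_sum fun i _ => ?_)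
    refine (Finset.le_sum_of_subadditive N (map_zero N).le (map_add_le_add N) _ _).trans (Finset.sum_le_sum fun j _ => ?_)
    rw [← map_smul_eq_mul, Matrix.smul_single, smul_eq_mul, mul_one]
  have hlim : Filter.Tendsto (fun X : Matrix (Fin d) (Fin d) ℂ =>
      ∑ i, ∑ j, ‖X i j‖ * N (Matrix.single i j 1)) (nhds 0) (nhds 0) := by
    have : Continuous (fun X : Matrix (Fin d) (Fin d) ℂ =>
      ∑ i, ∑ j, ‖X i j‖ * N (Matrix.single i j 1)) := by fun_prop
    simpa using this.tendsto 0
  rw [ContinuousAt, map_zero]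
  exact squeeze_zero (fun X => apply_nonneg N X) hle hlim

end Norm

/-! ### Frame operators and the Schur–Horn theorem. -/

lemma isGBessel {d n m : ℕ} (T : Fin m → Matrix (Fin n) (Fin d) ℂ) : IsGBessel T := by
  -- The added `1` keeps the constant positive when all the operators vanish.
  refine ⟨∑ i, ‖(Matrix.toEuclideanLin (T i)).toContinuousLinearMap‖ ^ 2 + 1, by positivity,
    fun x => ?_⟩
  have : ∀ i, ‖WithLp.toLp 2 (T i *ᵥ x.ofLp)‖ ^ 2 ≤
      ‖(Matrix.toEuclideanLin (T i)).toContinuousLinearMap‖ ^ 2 * ‖x‖ ^ 2 := fun i => by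
    rw [← mul_pow]
    exact pow_le_pow_left₀ (norm_nonneg _)
      ((Matrix.toEuclideanLin (T i)).toContinuousLinearMap.le_opNorm x) 2
  refine (Finset.sum_le_sum fun i _ => this i).trans ?_
  rw [← Finset.sum_mul, add_mul]
  exact le_add_of_nonneg_right (by positivity)

lemma norm_sq_eq_re_trace {d : ℕ} (v : EuclideanSpace ℂ (Fin d)) :
    ‖v‖ ^ 2 = (Matrix.vecMulVec v.ofLp (star v.ofLp)).trace.re := by
  rw [EuclideanSpace.norm_sq_eq, Matrix.trace, Complex.re_sum]
  refine Finset.sum_congr rfl fun i _ => ?_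
  rw [Matrix.diag_apply, Matrix.vecMulVec_apply, Pi.star_apply, RCLike.star_def,
    Complex.mul_conj']
  norm_cast

lemma frobeniusSq_eq_sum {d n : ℕ} (T : Matrix (Fin n) (Fin d) ℂ) :
    frobeniusSq T = ∑ j, ∑ p, ‖T j p‖ ^ 2 := by
  rw [frobeniusSq, Matrix.trace_mul_comm, Matrix.trace, Complex.re_sum]
  refine Finset.sum_congr rfl fun j _ => ?_
  rw [Matrix.diag_apply, Matrix.mul_apply, Complex.re_sum]
  refine Finset.sum_congr rfl fun p _ => ?_
  rw [Matrix.conjTranspose_apply, RCLike.star_def, Complex.mul_conj']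
  norm_cast

lemma trace_frameOperator {d K : ℕ} (f : Fin K → EuclideanSpace ℂ (Fin d)) :
    (frameOperator f).trace.re = ∑ k, ‖f k‖ ^ 2 := by
  simp only [norm_sq_eq_re_trace, frameOperator, Matrix.trace_sum, Complex.re_sum]

lemma vecMulVec_mulVec_star {d : ℕ} (U : Matrix (Fin d) (Fin d) ℂ) (v : Fin d → ℂ) :
    Matrix.vecMulVec (U *ᵥ v) (star (U *ᵥ v)) = U * Matrix.vecMulVec v (star v) * Uᴴ := by
  rw [Matrix.star_mulVec, Matrix.mul_vecMulVec, Matrix.vecMulVec_mul]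

lemma frameOperator_mulVec {d K : ℕ} (U : Matrix (Fin d) (Fin d) ℂ)
    (f : Fin K → EuclideanSpace ℂ (Fin d)) :
    frameOperator (fun k => WithLp.toLp 2 (U *ᵥ (f k).ofLp)) = U * frameOperator f * Uᴴ := by
  simp only [frameOperator, vecMulVec_mulVec_star, Finset.mul_sum, Finset.sum_mul]

lemma norm_sq_mulVec_of_mem_unitaryGroup {d : ℕ} {U : Matrix (Fin d) (Fin d) ℂ}
    (hU : U ∈ Matrix.unitaryGroup (Fin d) ℂ) (v : EuclideanSpace ℂ (Fin d)) :
    ‖WithLp.toLp 2 (U *ᵥ v.ofLp)‖ ^ 2 = ‖v‖ ^ 2 := by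
  have hU' : Uᴴ * U = 1 := Matrix.mem_unitaryGroup_iff'.1 hU
  rw [norm_sq_eq_re_trace, norm_sq_eq_re_trace, vecMulVec_mulVec_star, Matrix.trace_mul_comm,
    ← Matrix.mul_assoc, hU', Matrix.one_mul]

lemma inner_frameOperator {d K : ℕ} (f : Fin K → EuclideanSpace ℂ (Fin d))
    (w : EuclideanSpace ℂ (Fin d)) :
    inner ℂ w (Matrix.toEuclideanLin (frameOperator f) w) =
      ((∑ k, ‖inner ℂ (f k) w‖ ^ 2 : ℝ) : ℂ) := by
  have h1 : Matrix.toEuclideanLin (frameOperator f) w = ∑ k, inner ℂ (f k) w • f k := by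
    rw [frameOperator, map_sum, LinearMap.sum_apply]
    refine Finset.sum_congr rfl fun k _ => ?_
    ext p
    rw [Matrix.ofLp_toLpLin, Matrix.toLin'_apply, Matrix.vecMulVec_mulVec,
      EuclideanSpace.inner_eq_star_dotProduct, dotProduct_comm]
    simp [mul_comm]
  rw [h1, inner_sum]
  push_cast
  refine Finset.sum_congr rfl fun k _ => ?_
  rw [inner_smul_right, ← inner_conj_symm w (f k), Complex.mul_conj']

lemma isHermitian_frameOperator {d K : ℕ} (f : Fin K → EuclideanSpace ℂ (Fin d)) :
    (frameOperator f).IsHermitian := by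
  rw [Matrix.IsHermitian, frameOperator, Matrix.conjTranspose_sum]
  exact Finset.sum_congr rfl fun k _ => by rw [Matrix.conjTranspose_vecMulVec, star_star]

/-- Supplies the phase that removes the cross term when two vectors are mixed in `exists_rotation`.
-/
lemma exists_norm_one_re_mul_eq_zero (z : ℂ) : ∃ u : ℂ, ‖u‖ = 1 ∧ (u * z).re = 0 := by
  rcases eq_or_ne z 0 with rfl | hz
  · exact ⟨1, by simp⟩
  · have hz' : ‖z‖ ≠ 0 := norm_ne_zero_iff.2 hz
    refine ⟨Complex.I * (starRingEnd ℂ z / ‖z‖), by simp [hz'], ?_⟩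
    have : Complex.I * (starRingEnd ℂ z / ‖z‖) * z = Complex.I * (‖z‖ : ℂ) := by
      have hz'' : (‖z‖ : ℂ) ≠ 0 := by exact_mod_cast hz'
      rw [mul_assoc, div_mul_eq_mul_div, Complex.conj_mul', sq, mul_div_assoc, div_self hz'',
        mul_one]
    rw [this]
    simp

/-- Rotating a pair of vectors changes their norms but not their frame operator. -/
lemma exists_rotation {d : ℕ} (f g : EuclideanSpace ℂ (Fin d)) {r : ℝ} (h1 : ‖g‖ ^ 2 ≤ r)
    (h2 : r ≤ ‖f‖ ^ 2) :
    ∃ f' g' : EuclideanSpace ℂ (Fin d), ‖f'‖ ^ 2 = r ∧ ‖g'‖ ^ 2 = ‖f‖ ^ 2 + ‖g‖ ^ 2 - r ∧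
      Matrix.vecMulVec f'.ofLp (star f'.ofLp) + Matrix.vecMulVec g'.ofLp (star g'.ofLp) =
      Matrix.vecMulVec f.ofLp (star f.ofLp) + Matrix.vecMulVec g.ofLp (star g.ofLp) := by
  obtain ⟨u, hu, hre⟩ := exists_norm_one_re_mul_eq_zero (inner ℂ f g)
  -- Without a cross term, `‖c f + s u g‖²` is the convex combination of `‖f‖²` and `‖g‖²` with
  -- weights `c²`, `s²`, so it reaches every value in between.
  obtain ⟨c, s, hcs, hr⟩ : ∃ c s : ℝ, c ^ 2 + s ^ 2 = 1 ∧
      c ^ 2 * ‖f‖ ^ 2 + s ^ 2 * ‖g‖ ^ 2 = r := by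
    rcases (h1.trans h2).eq_or_lt with heq | hlt
    · exact ⟨1, 0, by norm_num, by linarith⟩
    · have hpos : 0 < ‖f‖ ^ 2 - ‖g‖ ^ 2 := sub_pos.2 hlt
      refine ⟨√((r - ‖g‖ ^ 2) / (‖f‖ ^ 2 - ‖g‖ ^ 2)), √((‖f‖ ^ 2 - r) / (‖f‖ ^ 2 - ‖g‖ ^ 2)), ?_, ?_⟩
      all_goals
        rw [Real.sq_sqrt (div_nonneg (by linarith) hpos.le),
          Real.sq_sqrt (div_nonneg (by linarith) hpos.le)]
        field_simp
        ring
  have huu : u * starRingEnd ℂ u = 1 := by rw [Complex.mul_conj', hu]; norm_num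
  have hnorm : ‖((c : ℂ) • f + ((s : ℂ) * u) • g)‖ ^ 2 = r := by
    rw [norm_add_sq (𝕜 := ℂ), inner_smul_left, inner_smul_right, norm_smul, norm_smul, norm_mul, hu,
      Complex.norm_real, Complex.norm_real, mul_one, mul_pow, mul_pow, Real.norm_eq_abs,
      Real.norm_eq_abs, sq_abs, sq_abs, Complex.conj_ofReal]
    have : (c : ℂ) * (s * u * inner ℂ f g) = ((c * s : ℝ) : ℂ) * (u * inner ℂ f g) := by
      push_cast
      ring
    rw [this, RCLike.re_eq_complex_re, Complex.re_ofReal_mul, hre]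
    linarith
  set f' := (c : ℂ) • f + ((s : ℂ) * u) • g with hf'
  -- The coefficients of `f'` and `g'` form a unitary `2 × 2` matrix, so the sum of the rank-one
  -- operators is preserved; its trace then gives the norm of `g'`.
  set g' := (-((s : ℂ) * starRingEnd ℂ u)) • f + (c : ℂ) • g with hg'
  have hop : Matrix.vecMulVec f'.ofLp (star f'.ofLp) + Matrix.vecMulVec g'.ofLp (star g'.ofLp) =
      Matrix.vecMulVec f.ofLp (star f.ofLp) + Matrix.vecMulVec g.ofLp (star g.ofLp) := by
    have hcs' : (c : ℂ) ^ 2 + (s : ℂ) ^ 2 = 1 := by exact_mod_cast hcs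
    ext p q
    simp only [hf', hg', Matrix.add_apply, Matrix.vecMulVec_apply, Pi.star_apply, PiLp.add_apply,
      PiLp.smul_apply, smul_eq_mul, RCLike.star_def, map_add, map_mul, map_neg, Complex.conj_ofReal,
      Complex.conj_conj]
    linear_combination (f.ofLp p * starRingEnd ℂ (f.ofLp q) + g.ofLp p * starRingEnd ℂ (g.ofLp q)) *
      (hcs' + (s : ℂ) ^ 2 * huu)
  refine ⟨f', g', hnorm, ?_, hop⟩
  have := congrArg (fun M => M.trace.re) hop
  simp only [Matrix.trace_add, Complex.add_re, ← norm_sq_eq_re_trace, hnorm] at this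
  linarith

/-- The Schur–Horn theorem for finite sequences of vectors: the squared norms can be changed to any
non-increasing vector with smaller partial sums, keeping the frame operator. -/
lemma exists_frameOperator_eq_of_headSum_le {d K : ℕ} {a : Fin K → ℝ} (ha : Antitone a)
    (f : Fin K → EuclideanSpace ℂ (Fin d))
    (h : ∀ t, headSum a t ≤ headSum (fun k => ‖f k‖ ^ 2) t)
    (htot : ∑ k, a k = ∑ k, ‖f k‖ ^ 2) :
    ∃ g ∈ vectorTorus d a, frameOperator g = frameOperator f := by
  -- Induct on the number of wrong norms: each rotation corrects at least one and spoils none.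
  induction hn : (Finset.univ.filter fun k => ‖f k‖ ^ 2 ≠ a k).card using Nat.strong_induction_on
    generalizing f with
  | _ n ih =>
  by_cases hall : ∀ k, ‖f k‖ ^ 2 = a k
  · exact ⟨f, hall, rfl⟩
  -- `k` is the first index with too small a norm; comparing partial sums through `k` yields an
  -- earlier `j` with too large a norm.
  obtain ⟨k, hk, hkmin⟩ : ∃ k, ‖f k‖ ^ 2 < a k ∧ ∀ i < k, a i ≤ ‖f i‖ ^ 2 := by
    have hex : (Finset.univ.filter fun k => ‖f k‖ ^ 2 < a k).Nonempty := by
      by_contra hempty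
      have hle : ∀ k, a k ≤ ‖f k‖ ^ 2 := fun k => not_lt.1 fun hlt =>
        hempty ⟨k, by simpa using hlt⟩
      refine hall fun k => ?_
      exact ((Finset.sum_eq_sum_iff_of_le fun k _ => hle k).1 htot k (Finset.mem_univ k)).symm
    refine ⟨_, (Finset.mem_filter.1 (Finset.min'_mem _ hex)).2, fun i hi => not_lt.1 fun hlt => ?_⟩
    exact not_le.2 hi (Finset.min'_le _ i (by simpa using hlt))
  obtain ⟨j, hjk, hj⟩ : ∃ j < k, a j < ‖f j‖ ^ 2 := by
    by_contra! hno
    have h1 := h (k.val + 1)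
    rw [headSum_succ, headSum_succ] at h1
    have h2 : headSum (fun k => ‖f k‖ ^ 2) k.val ≤ headSum a k.val :=
      Finset.sum_le_sum fun i hi => hno i (by simpa using hi)
    linarith
  -- The largest transfer that overshoots neither target, so one of the two becomes exact.
  set ε := min (‖f j‖ ^ 2 - a j) (a k - ‖f k‖ ^ 2)
  have hε : 0 < ε := lt_min (sub_pos.2 hj) (sub_pos.2 hk)
  have hεj : ε ≤ ‖f j‖ ^ 2 - a j := min_le_left _ _
  have hεk : ε ≤ a k - ‖f k‖ ^ 2 := min_le_right _ _
  have hajk := ha hjk.le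
  obtain ⟨u, v, hu, hv, huv⟩ := exists_rotation (f j) (f k) (r := ‖f j‖ ^ 2 - ε)
    (by linarith) (by linarith)
  set g := Function.update (Function.update f j u) k v
  have hgk : g k = v := Function.update_self ..
  have hgj : g j = u := by
    rw [show g j = Function.update f j u j from Function.update_of_ne hjk.ne _ _,
      Function.update_self]
  have hg : ∀ i, i ≠ j → i ≠ k → g i = f i := fun i hij hik => by
    rw [show g i = Function.update f j u i from Function.update_of_ne hik _ _,
      Function.update_of_ne hij]
  have hgnorm : (fun i => ‖g i‖ ^ 2) =
      (fun i => ‖f i‖ ^ 2) + Pi.single k ε - Pi.single j ε := by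
    ext i
    by_cases hij : i = j
    · subst hij
      simp [hgj, hu, hjk.ne]
    · by_cases hik : i = k
      · subst hik
        simp only [hgk, hv, Pi.sub_apply, Pi.add_apply, Pi.single_eq_same, Pi.single_eq_of_ne hij]
        ring
      · simp [hg i hij hik, hij, hik]
  have hgop : frameOperator g = frameOperator f := by
    rw [← sub_eq_zero, frameOperator, frameOperator, ← Finset.sum_sub_distrib,
      Fintype.sum_eq_add j k hjk.ne fun i hi => by rw [hg i hi.1 hi.2, sub_self], hgj, hgk,
      sub_add_sub_comm, huv, sub_self]
  have hcard : (Finset.univ.filter fun i => ‖g i‖ ^ 2 ≠ a i).card < n := by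
    rw [← hn]
    have hgj' := congrFun hgnorm j
    have hgk' := congrFun hgnorm k
    simp only [Pi.add_apply, Pi.sub_apply, Pi.single_eq_same, Pi.single_eq_of_ne hjk.ne,
      Pi.single_eq_of_ne hjk.ne'] at hgj' hgk'
    refine Finset.card_lt_card (Finset.ssubset_iff_of_subset (fun i hi => ?_) |>.2 ?_)
    · rw [Finset.mem_filter] at hi ⊢
      refine ⟨hi.1, ?_⟩
      by_cases hij : i = j
      · rw [hij]
        exact hj.ne'
      · by_cases hik : i = k
        · rw [hik]
          exact hk.ne
        · rw [← hg i hij hik]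
          exact hi.2
    · rcases min_choice (‖f j‖ ^ 2 - a j) (a k - ‖f k‖ ^ 2) with hc | hc
      · refine ⟨j, by simpa using hj.ne', ?_⟩
        have : ε = ‖f j‖ ^ 2 - a j := hc
        simp only [Finset.mem_filter, Finset.mem_univ, true_and, not_not]
        linarith
      · refine ⟨k, by simpa using hk.ne, ?_⟩
        have : ε = a k - ‖f k‖ ^ 2 := hc
        simp only [Finset.mem_filter, Finset.mem_univ, true_and, not_not]
        linarith
  have hhead : ∀ t, headSum a t ≤ headSum (fun i => ‖g i‖ ^ 2) t := by
    intro t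
    have h0 := h t
    rw [hgnorm, headSum_sub, headSum_add, headSum_single, headSum_single]
    split_ifs with hkt hjt hjt
    · linarith
    · linarith
    · have h1 : headSum ((fun k => ‖f k‖ ^ 2) - a) t ≥ ‖f j‖ ^ 2 - a j := by
        refine Finset.single_le_sum (f := (fun k => ‖f k‖ ^ 2) - a) (fun i hi => ?_)
          (by simpa using hjt)
        have : i.val < t := by simpa using hi
        exact sub_nonneg.2 (hkmin i (Fin.lt_def.2 (by omega)))
      rw [headSum_sub] at h1
      linarith
    · linarith
  have htot' : ∑ i, a i = ∑ i, ‖g i‖ ^ 2 := by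
    rw [htot, ← trace_frameOperator, ← trace_frameOperator, hgop]
  obtain ⟨g', hg', hg'op⟩ := ih _ hcard g hhead htot' rfl
  exact ⟨g', hg', hg'op.trans hgop⟩

/-- Extension by zero allows comparing partial sums of vectors of different lengths, `K` and `d`. -/
lemma headSum_eq_sum_range {K : ℕ} (x : Fin K → ℝ) (k : ℕ) :
    headSum x k = ∑ i ∈ Finset.range k, if h : i < K then x ⟨i, h⟩ else 0 := by
  induction k with
  | zero => simp [headSum_zero]
  | succ k ih =>
    rw [Finset.sum_range_succ, ← ih]
    split_ifs with h
    · exact headSum_succ x ⟨k, h⟩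
    · rw [headSum_of_le _ (by omega), headSum_of_le _ (by omega), add_zero]

/-- Start from the vectors `√(ν k) e_k`, with zero for `k ≥ d`, and correct their norms by
Schur–Horn. -/
lemma exists_frameOperator_eq_realDiagonal {d K : ℕ} {lam b : Fin d → ℝ} {a : Fin K → ℝ}
    (ha : Antitone a) (ha0 : ∀ k, 0 ≤ a k) (hb : IsLevelVector lam a b) :
    ∃ f ∈ vectorTorus d a, frameOperator f = realDiagonal fun i => max (lam i - b i) 0 := by
  set ν : Fin d → ℝ := fun i => max (lam i - b i) 0
  have hν : ∀ i, 0 ≤ ν i := fun i => le_max_right _ _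
  set f : Fin K → EuclideanSpace ℂ (Fin d) := fun k =>
    if h : k.val < d then EuclideanSpace.single ⟨k.val, h⟩ (√(ν ⟨k.val, h⟩) : ℂ) else 0 with hf
  have hnorm : ∀ k, ‖f k‖ ^ 2 = if h : k.val < d then ν ⟨k.val, h⟩ else 0 := fun k => by
    simp only [hf]
    split_ifs with h
    · rw [PiLp.norm_single, Complex.norm_real, Real.norm_of_nonneg (Real.sqrt_nonneg _),
        Real.sq_sqrt (hν _)]
    · simp
  have hhead : ∀ t ≤ K, headSum (fun k => ‖f k‖ ^ 2) t = headSum ν t := fun t ht => by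
    rw [headSum_eq_sum_range, headSum_eq_sum_range]
    refine Finset.sum_congr rfl fun i hi => ?_
    rw [dif_pos ((Finset.mem_range.1 hi).trans_le ht), hnorm]
  have hle : ∀ t, headSum a t ≤ headSum ν t := fun t => by
    rcases le_total t d with ht | ht
    · exact hb.headSum_le t ht
    · rw [headSum_of_le ν ht, ← hb.total]
      exact headSum_le_sum ha0 t
  -- When `K < d`, the first `K` entries of `ν` already carry the total of `a`, so the rest vanish
  -- and `K` vectors are enough.
  have htotK : headSum ν K = ∑ i, ν i := by
    refine (headSum_le_sum hν K).antisymm ?_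
    rw [← hb.total, ← headSum_of_le a le_rfl]
    exact hle K
  have htot : ∑ k, a k = ∑ k, ‖f k‖ ^ 2 := by
    rw [← headSum_of_le (fun k => ‖f k‖ ^ 2) le_rfl, hhead K le_rfl, htotK, hb.total]
  obtain ⟨g, hg, hgf⟩ := exists_frameOperator_eq_of_headSum_le ha f (fun t => by
    rcases le_total t K with ht | ht
    · rw [hhead t ht]
      exact hle t
    · rw [headSum_of_le _ ht, headSum_of_le _ ht, htot]) htot
  refine ⟨g, hg, hgf.trans ?_⟩
  have htail : ∀ i : Fin d, K ≤ i.val → ν i = 0 := fun i hi => by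
    have h1 := headSum_add_tail ν K
    rw [htotK, add_eq_left] at h1
    exact (Finset.sum_eq_zero_iff_of_nonneg fun i _ => hν i).1 h1 i (by simpa using hi)
  have hvec : ∀ k, Matrix.vecMulVec (f k).ofLp (star (f k).ofLp) =
      Matrix.diagonal fun i : Fin d => if k.val = i.val then (ν i : ℂ) else 0 := fun k => by
    ext p q
    simp only [hf]
    split_ifs with h
    · have hsq : (√(ν ⟨k.val, h⟩) : ℂ) * √(ν ⟨k.val, h⟩) = (ν ⟨k.val, h⟩ : ℂ) := by
        exact_mod_cast Real.mul_self_sqrt (hν _)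
      by_cases hp : p = ⟨k.val, h⟩
      · subst hp
        by_cases hq : q = ⟨k.val, h⟩
        · subst hq
          simp [Matrix.vecMulVec_apply, hsq]
        · simp [Matrix.vecMulVec_apply, hq, Ne.symm hq]
      · have : k.val ≠ p.val := fun hkp => hp (Fin.ext hkp.symm)
        simp [Matrix.vecMulVec_apply, hp, Matrix.diagonal_apply, this]
    · have : k.val ≠ p.val := fun hkp => h (hkp ▸ p.isLt)
      simp [Matrix.vecMulVec_apply, Matrix.diagonal_apply, this]
  ext p q
  rw [frameOperator, Matrix.sum_apply]
  simp only [hvec, realDiagonal, Matrix.diagonal_apply]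
  split_ifs with hpq
  · by_cases hp : p.val < K
    · rw [Finset.sum_eq_single ⟨p.val, hp⟩ (fun k _ hk => if_neg fun h => hk (Fin.ext h)) (by simp)]
      simp
    · rw [htail p (not_lt.1 hp), Finset.sum_eq_zero fun k _ => if_neg fun h : k.val = p.val =>
        hp (h ▸ k.isLt)]
      simp
  · simp

/-- A constant vector is majorized by every vector with its total: compare heads while `p` stays at
least `c`, and tails afterwards. -/
lemma headSum_const_le {n : ℕ} {p : Fin n → ℝ} (hp : Antitone p) {c : ℝ}
    (hc : ∑ _i : Fin n, c = ∑ i, p i) (t : ℕ) : headSum (fun _ : Fin n => c) t ≤ headSum p t := by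
  rcases le_or_gt n t with ht | ht
  · rw [headSum_of_le _ ht, headSum_of_le _ ht, hc]
  by_cases hk : c ≤ p ⟨t, ht⟩
  · refine Finset.sum_le_sum fun i hi => hk.trans (hp (Fin.le_def.2 ?_))
    exact le_of_lt (by simpa using hi)
  · have h1 := headSum_add_tail (fun _ : Fin n => c) t
    have h2 := headSum_add_tail p t
    have h3 : ∑ i ∈ Finset.univ.filter (fun i : Fin n => t ≤ i.val), p i ≤
        ∑ i ∈ Finset.univ.filter (fun i : Fin n => t ≤ i.val), c :=
      Finset.sum_le_sum fun i hi =>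
        (hp (Fin.le_def.2 (by simpa using hi : (⟨t, ht⟩ : Fin n).val ≤ i.val))).trans
          (not_le.1 hk).le
    linarith

lemma frameOperator_comp_perm {d K : ℕ} (f : Fin K → EuclideanSpace ℂ (Fin d))
    (σ : Equiv.Perm (Fin K)) : frameOperator (f ∘ σ) = frameOperator f :=
  Equiv.sum_comp σ fun k => Matrix.vecMulVec (f k).ofLp (star (f k).ofLp)

/-- `T* T` is the frame operator of vectors of equal norms, as many as `T` has rows. -/
lemma exists_equal_norm_vectors {d n : ℕ} (hn : 0 < n) (T : Matrix (Fin n) (Fin d) ℂ) :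
    ∃ g : Fin n → EuclideanSpace ℂ (Fin d),
      (∀ j, ‖g j‖ ^ 2 = frobeniusSq T / n) ∧ frameOperator g = Tᴴ * T := by
  set f : Fin n → EuclideanSpace ℂ (Fin d) := fun j => WithLp.toLp 2 (star (T j))
  have hfop : frameOperator f = Tᴴ * T := by
    ext p q
    rw [frameOperator, Matrix.sum_apply, Matrix.mul_apply]
    exact Finset.sum_congr rfl fun j _ => by
      simp [f, Matrix.vecMulVec_apply, Matrix.conjTranspose_apply]
  have hfnorm : ∑ j, ‖f j‖ ^ 2 = frobeniusSq T := by
    rw [← trace_frameOperator, hfop, frobeniusSq]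
  set σ : Equiv.Perm (Fin n) := Tuple.sort fun j => -‖f j‖ ^ 2
  have hσ : Antitone fun j => ‖(f ∘ σ) j‖ ^ 2 := fun i j hij => by
    have := Tuple.monotone_sort (fun j => -‖f j‖ ^ 2) hij
    simpa using this
  have htot : ∑ _j : Fin n, frobeniusSq T / n = ∑ j, ‖(f ∘ σ) j‖ ^ 2 := by
    rw [show ∑ j, ‖(f ∘ σ) j‖ ^ 2 = ∑ j, ‖f j‖ ^ 2 from Equiv.sum_comp σ fun j => ‖f j‖ ^ 2,
      hfnorm, Finset.sum_const, Finset.card_univ, Fintype.card_fin, nsmul_eq_mul]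
    field_simp
  obtain ⟨g, hg, hgop⟩ := exists_frameOperator_eq_of_headSum_le (a := fun _ => frobeniusSq T / n)
    (fun _ _ _ => le_rfl) (f ∘ σ) (headSum_const_le hσ htot) htot
  exact ⟨g, hg, hgop.trans ((frameOperator_comp_perm f σ).trans hfop)⟩

/-! ### Passing between operators and vectors with the spread weights. -/

section Reduction

variable {d n m : ℕ}

lemma gFrameOperator_gFrameOfVectors (f : Fin (m * n) → EuclideanSpace ℂ (Fin d)) :
    gFrameOperator (gFrameOfVectors f : Fin m → Matrix (Fin n) (Fin d) ℂ) = frameOperator f := by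
  rw [gFrameOperator, frameOperator, ← Equiv.sum_comp finProdFinEquiv, Fintype.sum_prod_type]
  refine Finset.sum_congr rfl fun i _ => ?_
  ext p q
  rw [Matrix.mul_apply, Matrix.sum_apply]
  exact Finset.sum_congr rfl fun j _ => by
    simp [gFrameOfVectors, Matrix.vecMulVec_apply, Matrix.conjTranspose_apply]

lemma gFrameOfVectors_mem_gBesselSet (hn : 0 < n) {α : Fin m → ℝ}
    {f : Fin (m * n) → EuclideanSpace ℂ (Fin d)} (hf : f ∈ vectorTorus d (spreadWeights n α)) :
    (gFrameOfVectors f : Fin m → Matrix (Fin n) (Fin d) ℂ) ∈ gBesselSet d n α := by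
  refine ⟨isGBessel _, fun i => ?_⟩
  have : ∀ j : Fin n, ∑ p, ‖gFrameOfVectors f i j p‖ ^ 2 = α i / n := fun j => by
    have h1 := hf (finProdFinEquiv (i, j))
    have h2 : (finProdFinEquiv (i, j)).divNat = i :=
      congrArg Prod.fst (finProdFinEquiv.symm_apply_apply (i, j))
    rw [EuclideanSpace.norm_sq_eq, spreadWeights, h2] at h1
    simpa [gFrameOfVectors] using h1
  rw [frobeniusSq_eq_sum]
  simp only [this, Finset.sum_const, Finset.card_univ, Fintype.card_fin, nsmul_eq_mul]
  field_simp

/-- The rows of each operator are equalized separately, which is where the weights `α i / n` come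
from. -/
lemma exists_frameOperator_eq_gFrameOperator (hn : 0 < n) {α : Fin m → ℝ}
    {F : Fin m → Matrix (Fin n) (Fin d) ℂ} (hF : F ∈ gBesselSet d n α) :
    ∃ f ∈ vectorTorus d (spreadWeights n α), frameOperator f = gFrameOperator F := by
  choose g hg hgop using fun i => exists_equal_norm_vectors hn (F i)
  refine ⟨fun k => g k.divNat k.modNat, fun k => by rw [hg, hF.2]; rfl, ?_⟩
  rw [frameOperator, ← Equiv.sum_comp finProdFinEquiv, Fintype.sum_prod_type, gFrameOperator]
  refine Finset.sum_congr rfl fun i _ => ?_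
  rw [← hgop i, frameOperator]
  refine Finset.sum_congr rfl fun j _ => ?_
  have h1 : (finProdFinEquiv (i, j)).divNat = i :=
    congrArg Prod.fst (finProdFinEquiv.symm_apply_apply (i, j))
  have h2 : (finProdFinEquiv (i, j)).modNat = j :=
    congrArg Prod.snd (finProdFinEquiv.symm_apply_apply (i, j))
  rw [h1, h2]

lemma antitone_spreadWeights {α : Fin m → ℝ} (hα : Antitone α) : Antitone (spreadWeights n α) :=
  fun _ _ hkl => div_le_div_of_nonneg_right (hα (Nat.div_le_div_right hkl)) (Nat.cast_nonneg n)

lemma spreadWeights_nonneg {α : Fin m → ℝ} (hα0 : ∀ i, 0 ≤ α i) (k : Fin (m * n)) :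
    0 ≤ spreadWeights n α k :=
  div_nonneg (hα0 _) (Nat.cast_nonneg n)

end Reduction

/-! ### Existence of best approximants by compactness. -/

section Existence

variable {d K : ℕ}

lemma isCompact_vectorTorus (a : Fin K → ℝ) : IsCompact (vectorTorus d a) := by
  have hbdd : vectorTorus d a ⊆ Set.univ.pi fun k => Metric.closedBall 0 √(a k) := fun f hf k _ => by
    rw [mem_closedBall_zero_iff, ← hf k, Real.sqrt_sq (norm_nonneg _)]
  refine (isCompact_univ_pi fun k => isCompact_closedBall _ _).of_isClosed_subset ?_ hbdd
  have : vectorTorus d a = ⋂ k, {f | ‖f k‖ ^ 2 = a k} := by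
    ext f
    simp [vectorTorus]
  rw [this]
  exact isClosed_iInter fun k => isClosed_eq (by fun_prop) continuous_const

lemma vectorTorus_nonempty (hd : 0 < d) {a : Fin K → ℝ} (ha : ∀ k, 0 ≤ a k) :
    (vectorTorus d a).Nonempty :=
  ⟨fun k => EuclideanSpace.single ⟨0, hd⟩ (√(a k) : ℂ), fun k => by
    rw [PiLp.norm_single, Complex.norm_real, Real.norm_of_nonneg (Real.sqrt_nonneg _),
      Real.sq_sqrt (ha k)]⟩

lemma continuous_frameOperator :
    Continuous (frameOperator : (Fin K → EuclideanSpace ℂ (Fin d)) → Matrix (Fin d) (Fin d) ℂ) := by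
  unfold frameOperator
  refine continuous_finsetSum _ fun k _ => Continuous.matrix_vecMulVec ?_ ?_ <;> fun_prop

lemma exists_best_vectors (hd : 0 < d) {a : Fin K → ℝ} (ha : ∀ k, 0 ≤ a k)
    (N : Seminorm ℂ (Matrix (Fin d) (Fin d) ℂ)) (A : Matrix (Fin d) (Fin d) ℂ) :
    ∃ f, IsBestApproximant N A frameOperator (vectorTorus d a) f := by
  have hcont : Continuous fun f : Fin K → EuclideanSpace ℂ (Fin d) => N (A - frameOperator f) :=
    N.continuous_matrix.comp (continuous_const.sub continuous_frameOperator)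
  obtain ⟨f, hf, hmin⟩ := (isCompact_vectorTorus a).exists_isMinOn (vectorTorus_nonempty hd ha)
    hcont.continuousOn
  exact ⟨f, hf, fun g hg => hmin hg⟩

end Existence

/-! ### Lidskii's equality case and the spectrum of a minimizer. -/

section Spectrum

variable {d K : ℕ}

lemma max_sub_zero_eq_sub_levelMin (lam b : Fin d → ℝ) (i : Fin d) :
    max (lam i - b i) 0 = lam i - levelMin lam b i := by
  rw [levelMin, ← max_sub_sub_left, sub_self]

lemma IsEigenbasis.inner_apply_eq {X : Matrix (Fin d) (Fin d) ℂ}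
    {e : OrthonormalBasis (Fin d) ℂ (EuclideanSpace ℂ (Fin d))} {x : Fin d → ℝ}
    (h : IsEigenbasis X e x) (j : Fin d) (w : EuclideanSpace ℂ (Fin d)) :
    inner ℂ (e j) (Matrix.toEuclideanLin X w) = (x j : ℂ) * inner ℂ (e j) w := by
  have h1 : Matrix.toEuclideanLin X w = ∑ j, (inner ℂ (e j) w * (x j : ℂ)) • e j := by
    conv_lhs => rw [← e.sum_repr' w, map_sum]
    exact Finset.sum_congr rfl fun j _ => by rw [map_smul, h j, smul_smul]
  rw [h1, e.orthonormal.inner_right_fintype, mul_comm]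

lemma sum_sum_mul_norm_inner_sq (u w : OrthonormalBasis (Fin d) ℂ (EuclideanSpace ℂ (Fin d)))
    (x : Fin d → ℝ) : ∑ i, ∑ j, x j * ‖inner ℂ (u j) (w i)‖ ^ 2 = ∑ j, x j := by
  rw [Finset.sum_comm]
  refine Finset.sum_congr rfl fun j _ => ?_
  rw [← Finset.mul_sum, w.sum_sq_norm_inner_left, u.orthonormal.1 j, one_pow, mul_one]

/-- If the diagonal of `X` in an orthonormal basis is the spectrum of `X`, then the basis consists
of eigenvectors. -/
lemma IsEigenbasis.of_diagonal_eq {X : Matrix (Fin d) (Fin d) ℂ}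
    {u w : OrthonormalBasis (Fin d) ℂ (EuclideanSpace ℂ (Fin d))} {x : Fin d → ℝ}
    (h : IsEigenbasis X u x) (hw : ∀ i, ∑ j, x j * ‖inner ℂ (u j) (w i)‖ ^ 2 = x i) :
    IsEigenbasis X w x := by
  have hnorm : ∀ i, ‖Matrix.toEuclideanLin X (w i)‖ ^ 2 =
      ∑ j, x j ^ 2 * ‖inner ℂ (u j) (w i)‖ ^ 2 := fun i => by
    rw [← u.sum_sq_norm_inner_right]
    refine Finset.sum_congr rfl fun j _ => ?_
    rw [h.inner_apply_eq, norm_mul, mul_pow, Complex.norm_real, Real.norm_eq_abs, sq_abs]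
  have hdiff : ∀ i, ‖Matrix.toEuclideanLin X (w i) - (x i : ℂ) • w i‖ ^ 2 =
      ‖Matrix.toEuclideanLin X (w i)‖ ^ 2 - x i ^ 2 := fun i => by
    rw [norm_sub_sq (𝕜 := ℂ), inner_smul_right, ← inner_conj_symm, h.inner_apply, hw,
      Complex.conj_ofReal, norm_smul, w.orthonormal.1 i, Complex.norm_real, Real.norm_eq_abs,
      mul_one, sq_abs, RCLike.re_eq_complex_re, ← Complex.ofReal_mul, Complex.ofReal_re]
    ring
  -- By `hdiff` and `hnorm`, the sum is the squared Frobenius norm of `X` minus the sum of its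
  -- squared eigenvalues.
  have hzero : ∑ i, ‖Matrix.toEuclideanLin X (w i) - (x i : ℂ) • w i‖ ^ 2 = 0 := by
    simp only [hdiff, hnorm, Finset.sum_sub_distrib,
      sum_sum_mul_norm_inner_sq u w fun j => x j ^ 2, sub_self]
  intro i
  have := (Finset.sum_eq_zero_iff_of_nonneg fun i _ => sq_nonneg _).1 hzero i (Finset.mem_univ i)
  exact sub_eq_zero.1 (norm_eq_zero.1 (pow_eq_zero_iff two_ne_zero |>.1 this))

/-- Ky Fan's inequality for the diagonal in an orthonormal basis. -/
lemma headSum_diagonal_le {x : Fin d → ℝ} (hx : Antitone x)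
    (u w : OrthonormalBasis (Fin d) ℂ (EuclideanSpace ℂ (Fin d))) (k : ℕ) :
    headSum (fun i => ∑ j, x j * ‖inner ℂ (u j) (w i)‖ ^ 2) k ≤ headSum x k := by
  rcases lt_or_ge k d with hk | hk
  · exact headSum_le_of_posPart hx (sum_posPart_le u x w.orthonormal) ⟨k, hk⟩
  · rw [headSum_of_le _ hk, headSum_of_le _ hk, sum_sum_mul_norm_inner_sq]

/-- Von Neumann's trace inequality, from Ky Fan's inequality and summation by parts. -/
lemma sum_mul_diagonal_le {c x : Fin d → ℝ} (hc : Antitone c) (hx : Antitone x)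
    (u w : OrthonormalBasis (Fin d) ℂ (EuclideanSpace ℂ (Fin d))) :
    ∑ i, c i * ∑ j, x j * ‖inner ℂ (u j) (w i)‖ ^ 2 ≤ ∑ i, c i * x i := by
  have := sum_mul_nonneg_of_headSum c (x - fun i => ∑ j, x j * ‖inner ℂ (u j) (w i)‖ ^ 2) hc
    (fun i j _ _ => by
      rw [headSum_sub]
      exact sub_nonneg.2 (headSum_diagonal_le hx u w _))
    (by simp only [Pi.sub_apply, Finset.sum_sub_distrib, sum_sum_mul_norm_inner_sq, sub_self])
  simpa only [Pi.sub_apply, mul_sub, Finset.sum_sub_distrib, sub_nonneg] using this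

/-- `(lam - b)⁺` is the nearest point to `lam` among the vectors that dominate the weights. -/
lemma IsLevelVector.sum_sq_add_le {lam b : Fin d → ℝ} {a : Fin K → ℝ} (hb : IsLevelVector lam a b)
    {μ : Fin d → ℝ} (hμ : μ ∈ dominatingVectors d a) :
    ∑ i, levelMin lam b i ^ 2 + ∑ i, (lam i - levelMin lam b i - μ i) ^ 2 ≤
      ∑ i, (lam i - μ i) ^ 2 := by
  set ν : Fin d → ℝ := fun i => max (lam i - b i) 0
  have hν : ∀ i, lam i - levelMin lam b i = ν i := fun i =>
    (max_sub_zero_eq_sub_levelMin lam b i).symm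
  -- At the jumps of `b` the partial sums of `ν` equal those of `a`, so those of `μ` are at least as
  -- large.
  have h1 : 0 ≤ ∑ i, (-b) i * (μ - ν) i := by
    refine sum_mul_nonneg_of_headSum _ _ (fun i j hij => neg_le_neg (hb.monotone hij))
      (fun i j hij hlt => ?_) ?_
    · rw [headSum_sub, sub_nonneg, ← hb.block_end i j hij (neg_lt_neg_iff.1 hlt)]
      exact hμ.2.1 _ j.isLt.le
    · simp only [Pi.sub_apply, Finset.sum_sub_distrib, hμ.2.2, hb.total, ν, sub_self]
  -- Where `b` exceeds `lam`, `ν` vanishes and replacing `b` by `lam` can only help since `μ ≥ 0`.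
  have h2 : ∑ i, (-b) i * (μ - ν) i ≤ ∑ i, levelMin lam b i * (ν i - μ i) := by
    refine Finset.sum_le_sum fun i _ => ?_
    simp only [Pi.neg_apply, Pi.sub_apply]
    rcases le_total (b i) (lam i) with h | h
    · rw [levelMin, min_eq_left h]
      linarith
    · have h0 : ν i = 0 := max_eq_right (by linarith)
      rw [levelMin, min_eq_right h, h0]
      nlinarith [hμ.1 i]
  have h3 : ∑ i, (lam i - μ i) ^ 2 = ∑ i, levelMin lam b i ^ 2 +
      ∑ i, (lam i - levelMin lam b i - μ i) ^ 2 + 2 * ∑ i, levelMin lam b i * (ν i - μ i) := by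
    rw [Finset.mul_sum, ← Finset.sum_add_distrib, ← Finset.sum_add_distrib]
    refine Finset.sum_congr rfl fun i _ => ?_
    rw [← hν]
    ring
  linarith

lemma frame_spectrum_mem_dominatingVectors {a : Fin K → ℝ}
    {f : Fin K → EuclideanSpace ℂ (Fin d)} (hf : f ∈ vectorTorus d a) :
    sortedEigenvalues (isHermitian_frameOperator f) ∈ dominatingVectors d a := by
  obtain ⟨u, hu⟩ := exists_isEigenbasis (isHermitian_frameOperator f)
  have hform : ∀ w, ∑ j, sortedEigenvalues (isHermitian_frameOperator f) j *
      ‖inner ℂ (u j) w‖ ^ 2 = ∑ k, ‖inner ℂ (f k) w‖ ^ 2 := fun w => by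
    exact_mod_cast (hu.inner_apply w).symm.trans (inner_frameOperator f w)
  have htot : ∑ k, a k = ∑ i, sortedEigenvalues (isHermitian_frameOperator f) i := by
    have := trace_frameOperator f
    rw [trace_eq_sum_sortedEigenvalues (isHermitian_frameOperator f), Complex.ofReal_re] at this
    rw [this]
    exact Finset.sum_congr rfl fun k _ => (hf k).symm
  refine ⟨fun i => ?_, fun k _ => headSum_le_of_frame_spectrum (sortedEigenvalues_antitone _) u hf
    hform htot k, htot.symm⟩
  have : sortedEigenvalues (isHermitian_frameOperator f) i = ∑ k, ‖inner ℂ (f k) (u i)‖ ^ 2 := by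
    rw [← hform, Finset.sum_eq_single i]
    · rw [inner_self_eq_norm_sq_to_K, u.orthonormal.1 i]
      simp
    · intro j _ hj
      rw [orthonormal_iff_ite.1 u.orthonormal, if_neg hj]
      simp
    · simp
  rw [this]
  positivity

/-- The equality case of Lidskii's inequality: if `A` and `S` have sorted spectra `x` and `y` and
`‖A - S‖₂² ≤ ‖x - y‖₂²`, they are diagonal in a common basis. -/
lemma exists_common_isEigenbasis {A S : Matrix (Fin d) (Fin d) ℂ} (hA : A.IsHermitian)
    (hS : S.IsHermitian) {r : ℝ}
    (h : ((A - S) * (A - S)).trace.re + r ≤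
      ∑ i, (sortedEigenvalues hA i - sortedEigenvalues hS i) ^ 2) (hr : 0 ≤ r) :
    r = 0 ∧ ∃ w, IsEigenbasis A w (sortedEigenvalues hA) ∧
      IsEigenbasis S w (sortedEigenvalues hS) := by
  set x := sortedEigenvalues hA
  set y := sortedEigenvalues hS
  have hx : Antitone x := sortedEigenvalues_antitone hA
  have hy : Antitone y := sortedEigenvalues_antitone hS
  obtain ⟨u, hu⟩ := exists_isEigenbasis hA
  obtain ⟨v, hv⟩ := exists_isEigenbasis hS
  -- The common basis will be an eigenbasis of `A + S`: the parallelogram law and the trace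
  -- inequality force its sorted spectrum `τ` to be `x + y`.
  obtain ⟨w, hw⟩ := exists_isEigenbasis (hA.add hS)
  set τ := sortedEigenvalues (hA.add hS)
  have hτ : Antitone τ := sortedEigenvalues_antitone _
  set p : Fin d → ℝ := fun i => ∑ j, x j * ‖inner ℂ (u j) (w i)‖ ^ 2
  set q : Fin d → ℝ := fun i => ∑ j, y j * ‖inner ℂ (v j) (w i)‖ ^ 2
  have hpq : ∀ i, p i + q i = τ i := fun i => by
    have h1 : inner ℂ (w i) (Matrix.toEuclideanLin (A + S) (w i)) = ((p i + q i : ℝ) : ℂ) := by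
      rw [map_add, LinearMap.add_apply, inner_add_right, hu.inner_apply, hv.inner_apply,
        Complex.ofReal_add]
    rw [hw i, inner_smul_right, inner_self_eq_norm_sq_to_K, w.orthonormal.1 i] at h1
    have h2 : (τ i : ℂ) = ((p i + q i : ℝ) : ℂ) := by simpa using h1
    exact_mod_cast h2.symm
  have hparallelogram : ∑ i, τ i ^ 2 + ((A - S) * (A - S)).trace.re =
      2 * ∑ i, x i ^ 2 + 2 * ∑ i, y i ^ 2 := by
    have h1 : (A + S) * (A + S) + (A - S) * (A - S) = A * A + A * A + (S * S + S * S) := by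
      noncomm_ring
    have h2 := congrArg (fun M => M.trace.re) h1
    simp only [Matrix.trace_add, trace_mul_self_eq_sum_sq hA, trace_mul_self_eq_sum_sq hS,
      trace_mul_self_eq_sum_sq (hA.add hS), Complex.add_re, Complex.ofReal_re] at h2
    linarith
  have hτ_le : ∑ i, τ i ^ 2 ≤ ∑ i, τ i * (x i + y i) := by
    have h1 := sum_mul_diagonal_le hτ hx u w
    have h2 := sum_mul_diagonal_le hτ hy v w
    calc ∑ i, τ i ^ 2 = ∑ i, τ i * p i + ∑ i, τ i * q i := by
          rw [← Finset.sum_add_distrib]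
          exact Finset.sum_congr rfl fun i _ => by rw [← mul_add, hpq, sq]
      _ ≤ ∑ i, τ i * x i + ∑ i, τ i * y i := add_le_add h1 h2
      _ = _ := by
          rw [← Finset.sum_add_distrib]
          exact Finset.sum_congr rfl fun i _ => (mul_add _ _ _).symm
  have hexpand : ∑ i, (τ i - (x i + y i)) ^ 2 = ∑ i, τ i ^ 2 - 2 * ∑ i, τ i * (x i + y i) +
      (2 * ∑ i, x i ^ 2 + 2 * ∑ i, y i ^ 2 - ∑ i, (x i - y i) ^ 2) := by
    simp only [Finset.mul_sum, ← Finset.sum_add_distrib, ← Finset.sum_sub_distrib]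
    exact Finset.sum_congr rfl fun i _ => by ring
  have hnonneg : 0 ≤ ∑ i, (τ i - (x i + y i)) ^ 2 := Finset.sum_nonneg fun i _ => sq_nonneg _
  have hzero : ∑ i, (τ i - (x i + y i)) ^ 2 = 0 := by linarith
  refine ⟨by linarith, w, ?_⟩
  have hτxy : ∀ i, τ i = x i + y i := fun i => by
    have := (Finset.sum_eq_zero_iff_of_nonneg fun i _ => sq_nonneg _).1 hzero i (Finset.mem_univ i)
    exact sub_eq_zero.1 (pow_eq_zero_iff two_ne_zero |>.1 this)
  -- Ky Fan's inequalities for `A` and `S` add up to an equality, so each is an equality and the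
  -- diagonals in `w` are the spectra.
  have hhead : ∀ k, headSum p k = headSum x k ∧ headSum q k = headSum y k := fun k => by
    have h1 : headSum p k ≤ headSum x k := headSum_diagonal_le hx u w k
    have h2 : headSum q k ≤ headSum y k := headSum_diagonal_le hy v w k
    have h3 : headSum p k + headSum q k = headSum x k + headSum y k := by
      rw [← headSum_add, ← headSum_add]
      congr 1
      ext i
      exact (hpq i).trans (hτxy i)
    exact ⟨by linarith, by linarith⟩
  have heq : ∀ {s z : Fin d → ℝ}, (∀ k, headSum s k = headSum z k) → ∀ i, s i = z i :=
    fun hsz i => by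
      have h1 := hsz (i.val + 1)
      rw [headSum_succ, headSum_succ, hsz] at h1
      exact add_left_cancel h1
  exact ⟨hu.of_diagonal_eq (heq fun k => (hhead k).1), hv.of_diagonal_eq (heq fun k => (hhead k).2)⟩

variable {A : Matrix (Fin d) (Fin d) ℂ} (hA : A.IsHermitian) {a : Fin K → ℝ} {b : Fin d → ℝ}

/-- The spectrum gives `tr (A - S)² = ∑ δ²`. The excess in the nearest-point inequality serves as
the slack `r` in Lidskii's inequality; its vanishing identifies the spectrum of `S` with `λ - δ`. -/
lemma exists_unitary_of_hasSpectrum (hb : IsLevelVector (sortedEigenvalues hA) a b)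
    {f : Fin K → EuclideanSpace ℂ (Fin d)} (hf : f ∈ vectorTorus d a)
    (h : HasSpectrum (A - frameOperator f) (levelMin (sortedEigenvalues hA) b)) :
    ∃ U ∈ Matrix.unitaryGroup (Fin d) ℂ,
      A = U * realDiagonal (sortedEigenvalues hA) * Uᴴ ∧
      frameOperator f = U * realDiagonal (fun i => sortedEigenvalues hA i -
        levelMin (sortedEigenvalues hA) b i) * Uᴴ := by
  have hS := isHermitian_frameOperator f
  have hle := hb.sum_sq_add_le (frame_spectrum_mem_dominatingVectors hf)
  obtain ⟨hr, w, hwA, hwS⟩ := exists_common_isEigenbasis hA hS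
    (r := ∑ i, (sortedEigenvalues hA i - levelMin (sortedEigenvalues hA) b i -
      sortedEigenvalues hS i) ^ 2)
    (by rwa [h.trace_mul_self (hA.sub hS), Complex.ofReal_re])
    (Finset.sum_nonneg fun i _ => sq_nonneg _)
  have hμ : (fun i => sortedEigenvalues hA i - levelMin (sortedEigenvalues hA) b i) =
      sortedEigenvalues hS := by
    ext i
    have := (Finset.sum_eq_zero_iff_of_nonneg fun i _ => sq_nonneg _).1 hr i (Finset.mem_univ i)
    exact sub_eq_zero.1 (pow_eq_zero_iff two_ne_zero |>.1 this)
  refine ⟨basisMatrix w, basisMatrix_mem_unitaryGroup w, hwA.eq_conj, ?_⟩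
  rw [hμ]
  exact hwS.eq_conj

lemma hasSpectrum_sub_of_conj {S U : Matrix (Fin d) (Fin d) ℂ} {x y : Fin d → ℝ}
    (hU : U ∈ Matrix.unitaryGroup (Fin d) ℂ) (hAU : A = U * realDiagonal x * Uᴴ)
    (hSU : S = U * realDiagonal (fun i => x i - y i) * Uᴴ) : HasSpectrum (A - S) y := by
  have : A - S = U * realDiagonal y * Uᴴ := by
    rw [hAU, hSU, ← Matrix.sub_mul, ← Matrix.mul_sub]
    congr 2
    rw [realDiagonal, realDiagonal, realDiagonal, Matrix.diagonal_sub]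
    simp
  rw [this]
  exact hasSpectrum_conj y hU

/-- The diagonal construction is carried to an eigenbasis of `A`, which preserves the norms of the
vectors. -/
lemma exists_vectors_hasSpectrum (ha : Antitone a) (ha0 : ∀ k, 0 ≤ a k)
    (hb : IsLevelVector (sortedEigenvalues hA) a b) :
    ∃ f ∈ vectorTorus d a,
      HasSpectrum (A - frameOperator f) (levelMin (sortedEigenvalues hA) b) := by
  obtain ⟨f, hf, hfop⟩ := exists_frameOperator_eq_realDiagonal ha ha0 hb
  obtain ⟨u, hu⟩ := exists_isEigenbasis hA
  have hU := basisMatrix_mem_unitaryGroup u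
  refine ⟨fun k => WithLp.toLp 2 (basisMatrix u *ᵥ (f k).ofLp), fun k => ?_,
    hasSpectrum_sub_of_conj hU hu.eq_conj ?_⟩
  · exact (norm_sq_mulVec_of_mem_unitaryGroup hU (f k)).trans (hf k)
  · rw [frameOperator_mulVec, hfop]
    simp only [max_sub_zero_eq_sub_levelMin]

/-- Combines majorization of the residual, equality of traces, Rado's theorem and strict convexity.
-/
lemma IsStrictlyConvexUIN.lt_or_hasSpectrum {N : Seminorm ℂ (Matrix (Fin d) (Fin d) ℂ)}
    (hN : IsStrictlyConvexUIN N) (hb : IsLevelVector (sortedEigenvalues hA) a b)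
    {f : Fin K → EuclideanSpace ℂ (Fin d)} (hf : f ∈ vectorTorus d a) :
    N (realDiagonal (levelMin (sortedEigenvalues hA) b)) < N (A - frameOperator f) ∨
      HasSpectrum (A - frameOperator f) (levelMin (sortedEigenvalues hA) b) := by
  have hX := hA.sub (isHermitian_frameOperator f)
  obtain ⟨u, hu⟩ := exists_isEigenbasis hA
  obtain ⟨e, he⟩ := exists_isEigenbasis hX
  have hform : ∀ w, ∑ j, sortedEigenvalues hX j * ‖inner ℂ (e j) w‖ ^ 2 =
      ∑ j, sortedEigenvalues hA j * ‖inner ℂ (u j) w‖ ^ 2 - ∑ k, ‖inner ℂ (f k) w‖ ^ 2 := fun w => by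
    have h1 := he.inner_apply w
    rw [map_sub, LinearMap.sub_apply, inner_sub_right, hu.inner_apply, inner_frameOperator] at h1
    exact_mod_cast h1.symm
  have htot : ∑ i, levelMin (sortedEigenvalues hA) b i = ∑ i, sortedEigenvalues hX i := by
    have h1 := congrArg Complex.re (trace_eq_sum_sortedEigenvalues hX)
    rw [Matrix.trace_sub, Complex.sub_re, trace_eq_sum_sortedEigenvalues hA, trace_frameOperator,
      Complex.ofReal_re, Complex.ofReal_re] at h1
    have h2 : ∑ k, ‖f k‖ ^ 2 = ∑ k, a k := Finset.sum_congr rfl fun k _ => hf k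
    have h3 := hb.total
    simp only [max_sub_zero_eq_sub_levelMin, Finset.sum_sub_distrib] at h3
    linarith
  have hmem := mem_convexHull_perm_of_posPart (sortedEigenvalues_antitone hX)
    (sum_posPart_levelMin_le (sortedEigenvalues_antitone hA) hb u e hf hform) htot
  rw [hN.apply_eq_realDiagonal hX (hasSpectrum_sortedEigenvalues hX)]
  refine (hN.lt_or_eq_comp_perm hmem).imp_right ?_
  rintro ⟨σ, hσ⟩
  rw [hσ]
  exact (hasSpectrum_sortedEigenvalues hX).comp_perm σ

end Spectrum

/-! ### Characterization of best approximants. -/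

section BestApproximants

variable {d n m : ℕ} {α : Fin m → ℝ} {A : Matrix (Fin d) (Fin d) ℂ}

/-- Both problems range over the same set of frame operators. -/
lemma isBestApproximant_gFrameOperator_iff (hn : 0 < n)
    (N : Seminorm ℂ (Matrix (Fin d) (Fin d) ℂ)) {F : Fin m → Matrix (Fin n) (Fin d) ℂ}
    (hF : F ∈ gBesselSet d n α) :
    IsBestApproximant N A gFrameOperator (gBesselSet d n α) F ↔
      ∃ f, IsBestApproximant N A frameOperator (vectorTorus d (spreadWeights n α)) f ∧
        frameOperator f = gFrameOperator F := by
  constructor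
  · intro h
    obtain ⟨f, hf, hfF⟩ := exists_frameOperator_eq_gFrameOperator hn hF
    refine ⟨f, ⟨hf, fun g hg => ?_⟩, hfF⟩
    rw [hfF, ← gFrameOperator_gFrameOfVectors g]
    exact h.2 _ (gFrameOfVectors_mem_gBesselSet hn hg)
  · rintro ⟨f, hf, hfF⟩
    refine ⟨hF, fun G hG => ?_⟩
    obtain ⟨g, hg, hgG⟩ := exists_frameOperator_eq_gFrameOperator hn hG
    rw [← hfF, ← hgG]
    exact hf.2 g hg

lemma isBestApproximant_gFrameOfVectors (hn : 0 < n) {N : Seminorm ℂ (Matrix (Fin d) (Fin d) ℂ)}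
    {f : Fin (m * n) → EuclideanSpace ℂ (Fin d)}
    (hf : IsBestApproximant N A frameOperator (vectorTorus d (spreadWeights n α)) f) :
    IsBestApproximant N A gFrameOperator (gBesselSet d n α)
      (gFrameOfVectors f : Fin m → Matrix (Fin n) (Fin d) ℂ) :=
  (isBestApproximant_gFrameOperator_iff hn N (gFrameOfVectors_mem_gBesselSet hn hf.1)).2
    ⟨f, hf, (gFrameOperator_gFrameOfVectors f).symm⟩

lemma exists_gBessel_hasSpectrum (hn : 0 < n) (hα : Antitone α) (hα0 : ∀ i, 0 ≤ α i)
    (hA : A.IsHermitian) {b : Fin d → ℝ}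
    (hb : IsLevelVector (sortedEigenvalues hA) (spreadWeights n α) b) :
    ∃ F ∈ gBesselSet d n α,
      HasSpectrum (A - gFrameOperator F) (levelMin (sortedEigenvalues hA) b) := by
  obtain ⟨f, hf, hfs⟩ := exists_vectors_hasSpectrum hA (antitone_spreadWeights hα)
    (spreadWeights_nonneg hα0) hb
  refine ⟨gFrameOfVectors f, gFrameOfVectors_mem_gBesselSet hn hf, ?_⟩
  rwa [gFrameOperator_gFrameOfVectors]

namespace IsStrictlyConvexUIN

variable {N : Seminorm ℂ (Matrix (Fin d) (Fin d) ℂ)}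

lemma lt_or_hasSpectrum_gFrame (hN : IsStrictlyConvexUIN N) (hn : 0 < n) (hA : A.IsHermitian)
    {b : Fin d → ℝ} (hb : IsLevelVector (sortedEigenvalues hA) (spreadWeights n α) b)
    {F : Fin m → Matrix (Fin n) (Fin d) ℂ} (hF : F ∈ gBesselSet d n α) :
    N (realDiagonal (levelMin (sortedEigenvalues hA) b)) < N (A - gFrameOperator F) ∨
      HasSpectrum (A - gFrameOperator F) (levelMin (sortedEigenvalues hA) b) := by
  obtain ⟨f, hf, hfF⟩ := exists_frameOperator_eq_gFrameOperator hn hF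
  rw [← hfF]
  exact hN.lt_or_hasSpectrum hA hb hf

lemma apply_sub_gFrameOperator (hN : IsStrictlyConvexUIN N) (hA : A.IsHermitian)
    {F : Fin m → Matrix (Fin n) (Fin d) ℂ} {x : Fin d → ℝ}
    (h : HasSpectrum (A - gFrameOperator F) x) :
    N (A - gFrameOperator F) = N (realDiagonal x) := by
  refine hN.apply_eq_realDiagonal (hA.sub ?_) h
  rw [Matrix.IsHermitian, gFrameOperator, Matrix.conjTranspose_sum]
  simp

lemma isLeast_gFrame (hN : IsStrictlyConvexUIN N) (hn : 0 < n) (hα : Antitone α)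
    (hα0 : ∀ i, 0 ≤ α i) (hA : A.IsHermitian) {b : Fin d → ℝ}
    (hb : IsLevelVector (sortedEigenvalues hA) (spreadWeights n α) b) :
    IsLeast ((fun F => N (A - gFrameOperator F)) '' gBesselSet d n α)
      (N (realDiagonal (levelMin (sortedEigenvalues hA) b))) := by
  obtain ⟨F, hF, hFs⟩ := exists_gBessel_hasSpectrum hn hα hα0 hA hb
  refine ⟨⟨F, hF, hN.apply_sub_gFrameOperator hA hFs⟩, ?_⟩
  rintro _ ⟨G, hG, rfl⟩
  rcases hN.lt_or_hasSpectrum_gFrame hn hA hb hG with hlt | hGs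
  exacts [hlt.le, (hN.apply_sub_gFrameOperator hA hGs).ge]

/-- The right-hand side does not involve `N`, which gives the independence of the norm. -/
lemma isBestApproximant_iff_hasSpectrum (hN : IsStrictlyConvexUIN N) (hn : 0 < n)
    (hα : Antitone α) (hα0 : ∀ i, 0 ≤ α i) (hA : A.IsHermitian) {b : Fin d → ℝ}
    (hb : IsLevelVector (sortedEigenvalues hA) (spreadWeights n α) b)
    {F : Fin m → Matrix (Fin n) (Fin d) ℂ} (hF : F ∈ gBesselSet d n α) :
    IsBestApproximant N A gFrameOperator (gBesselSet d n α) F ↔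
      HasSpectrum (A - gFrameOperator F) (levelMin (sortedEigenvalues hA) b) := by
  constructor
  · intro h
    obtain ⟨G, hG, hGs⟩ := exists_gBessel_hasSpectrum hn hα hα0 hA hb
    refine (hN.lt_or_hasSpectrum_gFrame hn hA hb hF).resolve_left (not_lt.2 ?_)
    exact (h.2 G hG).trans_eq (hN.apply_sub_gFrameOperator hA hGs)
  · intro h
    refine ⟨hF, fun G hG => ?_⟩
    rw [hN.apply_sub_gFrameOperator hA h]
    exact (hN.isLeast_gFrame hn hα hα0 hA hb).2 ⟨G, hG, rfl⟩

end IsStrictlyConvexUIN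

end BestApproximants

theorem theorem5p4 {d n m : ℕ} (hd : 0 < d) (hn : 0 < n)
    (α : Fin m → ℝ) (hα : Antitone α) (hα0 : ∀ i, 0 ≤ α i)
    (A : Matrix (Fin d) (Fin d) ℂ) (hA : A.PosSemidef) :
    -- existence of a best approximant
    (∀ N : Seminorm ℂ (Matrix (Fin d) (Fin d) ℂ), IsStrictlyConvexUIN N →
      ∃ F ∈ gBesselSet d n α, ∀ G ∈ gBesselSet d n α,
        N (A - gFrameOperator F) ≤ N (A - gFrameOperator G)) ∧
    -- reduction to the classical problem for vectors with the spread weights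
    (∀ N : Seminorm ℂ (Matrix (Fin d) (Fin d) ℂ), IsStrictlyConvexUIN N →
      (∃ r : ℝ,
        IsLeast ((fun F => N (A - gFrameOperator F)) '' gBesselSet d n α) r ∧
        IsLeast ((fun f => N (A - frameOperator f)) '' vectorTorus d (spreadWeights n α)) r) ∧
      (∀ F ∈ gBesselSet d n α,
        (IsBestApproximant N A gFrameOperator (gBesselSet d n α) F ↔
          ∃ f, IsBestApproximant N A frameOperator (vectorTorus d (spreadWeights n α)) f ∧
            frameOperator f = gFrameOperator F)) ∧
      (∀ f, IsBestApproximant N A frameOperator (vectorTorus d (spreadWeights n α)) f →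
        IsBestApproximant N A gFrameOperator (gBesselSet d n α)
            (gFrameOfVectors f : Fin m → Matrix (Fin n) (Fin d) ℂ) ∧
          gFrameOperator (gFrameOfVectors f : Fin m → Matrix (Fin n) (Fin d) ℂ) =
            frameOperator f)) ∧
    -- computation from the spectrum of `A` and the spread weights
    (∃ b, IsLevelVector (sortedEigenvalues hA.isHermitian) (spreadWeights n α) b) ∧
    (∀ b, IsLevelVector (sortedEigenvalues hA.isHermitian) (spreadWeights n α) b →
      ∀ N : Seminorm ℂ (Matrix (Fin d) (Fin d) ℂ), IsStrictlyConvexUIN N →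
        IsLeast ((fun F => N (A - gFrameOperator F)) '' gBesselSet d n α)
          (N (realDiagonal (levelMin (sortedEigenvalues hA.isHermitian) b))) ∧
        ∀ F ∈ gBesselSet d n α,
          (IsBestApproximant N A gFrameOperator (gBesselSet d n α) F ↔
            HasSpectrum (A - gFrameOperator F)
              (levelMin (sortedEigenvalues hA.isHermitian) b)) ∧
          (IsBestApproximant N A gFrameOperator (gBesselSet d n α) F ↔
            ∃ U ∈ Matrix.unitaryGroup (Fin d) ℂ,
              A = U * realDiagonal (sortedEigenvalues hA.isHermitian) * Uᴴ ∧
              gFrameOperator F =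
                U * realDiagonal (fun i => sortedEigenvalues hA.isHermitian i -
                  levelMin (sortedEigenvalues hA.isHermitian) b i) * Uᴴ)) ∧
    -- the best approximants do not depend on the norm
    (∀ N N' : Seminorm ℂ (Matrix (Fin d) (Fin d) ℂ),
      IsStrictlyConvexUIN N → IsStrictlyConvexUIN N' →
      ∀ F, IsBestApproximant N A gFrameOperator (gBesselSet d n α) F ↔
        IsBestApproximant N' A gFrameOperator (gBesselSet d n α) F) := by
  have hw0 : ∀ k, 0 ≤ spreadWeights n α k := spreadWeights_nonneg hα0
  have hlevel := exists_isLevelVector hd (sortedEigenvalues_antitone hA.isHermitian) hw0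
  refine ⟨fun N _ => ?_, fun N _ => ⟨?_, fun F hF => isBestApproximant_gFrameOperator_iff hn N hF,
    fun f hf => ⟨isBestApproximant_gFrameOfVectors hn hf, gFrameOperator_gFrameOfVectors f⟩⟩,
    hlevel, fun b hb N hN => ⟨hN.isLeast_gFrame hn hα hα0 hA.isHermitian hb, fun F hF => ?_⟩,
    fun N N' hN hN' F => ?_⟩
  · obtain ⟨f, hf⟩ := exists_best_vectors hd hw0 N A
    exact ⟨_, isBestApproximant_gFrameOfVectors hn hf⟩
  · obtain ⟨f, hf⟩ := exists_best_vectors hd hw0 N A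
    have hF := isBestApproximant_gFrameOfVectors hn hf
    refine ⟨N (A - frameOperator f), ⟨⟨_, hF.1, ?_⟩, ?_⟩, ⟨f, hf.1, rfl⟩, ?_⟩
    · simp only [gFrameOperator_gFrameOfVectors]
    · rintro _ ⟨G, hG, rfl⟩
      simpa only [gFrameOperator_gFrameOfVectors] using hF.2 G hG
    · rintro _ ⟨g, hg, rfl⟩
      exact hf.2 g hg
  · have hiff := hN.isBestApproximant_iff_hasSpectrum hn hα hα0 hA.isHermitian hb hF
    refine ⟨hiff, hiff.trans ⟨fun h => ?_, ?_⟩⟩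
    · obtain ⟨f, hf, hfF⟩ := exists_frameOperator_eq_gFrameOperator hn hF
      rw [← hfF] at h ⊢
      exact exists_unitary_of_hasSpectrum hA.isHermitian hb hf h
    · rintro ⟨U, hU, hAU, hSU⟩
      exact hasSpectrum_sub_of_conj hU hAU hSU
  -- Any single level vector provides a spectral criterion common to both norms.
  · obtain ⟨b, hb⟩ := hlevel
    by_cases hF : F ∈ gBesselSet d n α
    · rw [hN.isBestApproximant_iff_hasSpectrum hn hα hα0 hA.isHermitian hb hF,
        hN'.isBestApproximant_iff_hasSpectrum hn hα hα0 hA.isHermitian hb hF]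
    · exact ⟨fun h => absurd h.1 hF, fun h => absurd h.1 hF⟩
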